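/- **Setting.** Let $\mu$ be a probability distribution on $\mathbb R^d$ with finite second moments, mean zero and covariance $\Sigma\succ 0$, whose smallest and largest eigenvalues are $\lambda_{\min},\lambda_{\max}$. Write $\langle u,v\rangle_M=u^\top Mv$, $\|u\|_\Sigma=\sqrt{\langle u,u\rangle_\Sigma}$, $\cos_\Sigma(u,v)=\langle u,v\rangle_\Sigma/(\|u\|_\Sigma\|v\|_\Sigma)$, let $\|\cdot\|$ be the Euclidean norm, and let $\mathrm{Proj}^\Sigma_{w^\perp}v=v-\frac{\langle w,v\rangle_\Sigma}{\langle w,w\rangle_\Sigma}w$. For $\varepsilon\ge 0$, $\mu$ is *$\varepsilon$-elliptical along* a subspace $E\neq 0$ if for $\boldsymbol x\sim\mu$, all $v\in E\setminus\{0\}$ and all $u$ with $u^\top\Sigma v=0$, one has $|\mathbb E[u^\top \boldsymbol x\mid v^\top \boldsymbol x]|\le\varepsilon\|u\|_\Sigma$ almost surely. Let $\theta^*,\psi,\theta_0\in\mathbb R^d$ (ground truth, teacher, student) with $\|\theta^*\|_\Sigma=\|\psi\|_\Sigma=1$, $\theta_0\ne0$, $\tilde\theta_0=\theta_0/\|\theta_0\|_\Sigma$,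 and $$\langle\theta^*,\theta_0\rangle_{\Sigma}\ge0,\qquad \langle\theta^*,\theta_0\rangle_{\Sigma^2}\ge0,\qquad \langle\theta^*,\psi\rangle_{\Sigma^2}\ge0 .$$ Let $\sigma(r)=1/(1+e^{-r})$ (inverse temperature $\beta=1$), $m=\frac1{\|\theta_0\|_\Sigma}\mathbb E[\sigma(\theta_0^\top \boldsymbol x)\,\theta_0^\top \boldsymbol x]$, and $$\rho_\ell=\tfrac{\lambda_{\min}}2\,\mathbb E|\psi^\top \boldsymbol x|\,\cos_\Sigma(\Sigma\theta^*,\psi)-m\,\langle\Sigma\theta^*,\tilde\theta_0\rangle_\Sigma-2\lambda_{\max}\varepsilon,$$ $$\rho_\upsilon=m\,\big\langle\Sigma\,\mathrm{Proj}^\Sigma_{(\theta^*)^\perp}\tilde\theta_0,\tilde\theta_0\big\rangle_\Sigma-\tfrac{\lambda_{\max}}2\,\mathbb E|\psi^\top \boldsymbol x|\,\big|\cos_\Sigma(\Sigma\,\mathrm{Proj}^\Sigma_{(\theta^*)^\perp}\theta_0,\psi)\big|-2\lambda_{\max}\varepsilon$$ (a cosine with a zero vector is read as $0$), and $$\rho=(1-\cos_\Sigma^2(\theta^*,\theta_0))\,\rho_\ell+\cos_\Sigma(\theta^*,\theta_0)\,\rho_\upsilon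 .$$ SFT of $\theta_0$ on the teacher's pseudo-labels with step size $\eta$, batch size $B\ge1$ and $T\ge1$ steps is the process $\hat\theta_0=\theta_0$, $$\hat\theta_{t+1}=\hat\theta_t-\frac{\eta}{B}\sum_{i=1}^B\nabla_\theta\,\ell(\hat\theta_t;\boldsymbol x_i^{(t)},\boldsymbol y_i^{(t)}),$$ where the $\boldsymbol x_i^{(t)}$ are i.i.d. from $\mu$, $\boldsymbol y_i^{(t)}=\mathbf 1[\psi^\top \boldsymbol x_i^{(t)}\ge0]$, and $\ell(\theta;x,y)=-\log p_\theta(y\mid x)$ with $p_\theta(1\mid x)=\sigma(\theta^\top x)=1-p_\theta(0\mid x)$. **Theorem.** There are constants $C_0,C_1,C_2,C_3>0$, depending only on $\lambda_{\min}$ and $\lambda_{\max}$ (in particular not on $d$, $\mu$, $\varepsilon$, $\theta^*$, $\psi$, $\theta_0$), such that the following holds. Assume in addition that $\mu$ is $\varepsilon$-elliptical along $\mathrm{span}\{\psi,\theta_0\}$ and that $\rho>0$. Then there is $\tau$ with $0<\tau\le C_0\,\rho/\|\theta_0\|$ such that for every batch size $B\ge1$ and every integer $T\ge1$ for which $\eta:=\tau/T$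 satisfies $$\eta\le C_1\Big(\frac{\rho}{\|\theta_0\|+1+\varepsilon}\Big)^3,$$ it holds that $$\cos_\Sigma(\hat\theta_T,\theta^*)-\cos_\Sigma(\theta_0,\theta^*)\ \ge\ \Delta:=C_2\Big(\frac{\rho}{\|\theta_0\|+1+\varepsilon}\Big)^2$$ with failure probability at most $$C_3\,\frac{d}{B\Delta}\Big(\frac1{\|\theta_0\|\rho}+\frac1{\rho^2}\Big).$$ (When $\Sigma=I$, the condition $\rho>0$ already forces $\langle\theta^*,\psi\rangle_{\Sigma^2}\ge0$.) -/

import Mathlib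

open MeasureTheory ProbabilityTheory
open scoped Matrix

noncomputable section

namespace WeakToStrong

/-- Euclidean space `ℝ^d`. -/
abbrev Vec (d : ℕ) := EuclideanSpace ℝ (Fin d)

variable {d : ℕ}

/-- The matrix-vector product `M v`. -/
def act (M : Matrix (Fin d) (Fin d) ℝ) (v : Vec d) : Vec d :=
  WithLp.toLp 2 (M *ᵥ v.ofLp)

/-- `⟨x, y⟩_M = xᵀ M y`. -/
def innerM (M : Matrix (Fin d) (Fin d) ℝ) (x y : Vec d) : ℝ :=
  inner ℝ x (act M y)

/-- `‖x‖_M = √⟨x, x⟩_M`. -/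
def normM (M : Matrix (Fin d) (Fin d) ℝ) (x : Vec d) : ℝ :=
  Real.sqrt (innerM M x x)

/-- `cos_M(x, y) = ⟨x, y⟩_M / (‖x‖_M ‖y‖_M)`. -/
def cosM (M : Matrix (Fin d) (Fin d) ℝ) (x y : Vec d) : ℝ :=
  innerM M x y / (normM M x * normM M y)

/-- The `⟨·,·⟩_M`-orthogonal projection of `v` onto the `⟨·,·⟩_M`-orthogonal complement
of (the line spanned by) `w`. -/
def projPerp (M : Matrix (Fin d) (Fin d) ℝ) (w v : Vec d) : Vec d :=
  v - (innerM M w v / innerM M w w) • w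

/-- `x ∼ μ` has finite second moments, mean zero and positive-definite covariance `S`, and it
is `ε`-elliptical along the nontrivial subspace `E`: for `v ∈ E ∖ {0}` and `uᵀ S v = 0`,
`|𝔼[uᵀx ∣ vᵀx]| ≤ ε ‖u‖_S` almost surely. -/
structure IsElliptical (μ : Measure (Vec d)) (S : Matrix (Fin d) (Fin d) ℝ) (ε : ℝ)
    (E : Submodule ℝ (Vec d)) : Prop where
  memLp_two : MemLp (fun x : Vec d => x) 2 μ
  mean_zero : ∫ x, x ∂μ = 0
  covariance_eq : ∀ i j : Fin d,
    covariance (fun x : Vec d => x i) (fun x : Vec d => x j) μ = S i j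
  posDef : S.PosDef
  nontrivial : E ≠ ⊥
  condExp_le : ∀ v ∈ E, v ≠ 0 → ∀ u : Vec d, innerM S u v = 0 →
    ∀ᵐ x ∂μ,
      |condExp (MeasurableSpace.comap (fun x : Vec d => (inner ℝ v x : ℝ)) (borel ℝ)) μ
        (fun x : Vec d => (inner ℝ u x : ℝ)) x| ≤ ε * normM S u

/-- The logistic function `σ_β(r) = 1 / (1 + e^{-β r})` of inverse temperature `β`. -/
def logistic (β r : ℝ) : ℝ := 1 / (1 + Real.exp (-β * r))

/-- `p_θ(y ∣ x)` for a label `y ∈ {0, 1}`, where `p_θ(1 ∣ x) = σ_β(θᵀ x)`. -/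
def likelihood (β : ℝ) (θ x : Vec d) (y : Fin 2) : ℝ :=
  if y = 1 then logistic β (inner ℝ θ x) else 1 - logistic β (inner ℝ θ x)

/-- The logistic loss `ℓ_β(θ; x, y) = -log p_θ(y ∣ x)`. -/
def logisticLoss (β : ℝ) (θ x : Vec d) (y : Fin 2) : ℝ :=
  -Real.log (likelihood β θ x y)

/-- The teacher's pseudo-label `𝟙(ψᵀ x ≥ 0)`. -/
def pseudoLabel (ψ x : Vec d) : Fin 2 :=
  if 0 ≤ (inner ℝ ψ x : ℝ) then 1 else 0

/-- The mini-batch gradient `(1/B) ∑ᵢ ∇_θ ℓ_β(θ; xᵢ, yᵢ)`, with labels from the teacher. -/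
def batchGradient (β : ℝ) (ψ : Vec d) {B : ℕ} (x : Fin B → Vec d) (θ : Vec d) : Vec d :=
  (1 / (B : ℝ)) • ∑ i : Fin B,
    gradient (fun φ : Vec d => logisticLoss β φ (x i) (pseudoLabel ψ (x i))) θ

/-- The SFT iterates: `θ̂₀ = θ₀` and `θ̂_{t+1} = θ̂_t - η g_t`, where `g_t` is the mini-batch
gradient at `θ̂_t` on the `t`-th batch `x t`. -/
def sft (β : ℝ) (ψ : Vec d) (η : ℝ) {B : ℕ} (θ₀ : Vec d) (x : ℕ → Fin B → Vec d) :
    ℕ → Vec d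
  | 0 => θ₀
  | t + 1 => sft β ψ η θ₀ x t - η • batchGradient β ψ (x t) (sft β ψ η θ₀ x t)

/-- The confidence `m_{μ,β}(θ₀) = 𝔼[σ_β(θ₀ᵀ x) θ₀ᵀ x] / ‖θ₀‖_S`. -/
def confidence (μ : Measure (Vec d)) (S : Matrix (Fin d) (Fin d) ℝ) (β : ℝ) (θ₀ : Vec d) : ℝ :=
  (1 / normM S θ₀) * ∫ x, logistic β (inner ℝ θ₀ x) * inner ℝ θ₀ x ∂μ

/-- The normalization `θ̃₀ = θ₀ / ‖θ₀‖_S`. -/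
def normalized (S : Matrix (Fin d) (Fin d) ℝ) (θ₀ : Vec d) : Vec d :=
  (1 / normM S θ₀) • θ₀

/-- The term `ρ_ℓ`; `lmin`, `lmax` are the extreme eigenvalues of `S`. -/
def rhoLower (μ : Measure (Vec d)) (S : Matrix (Fin d) (Fin d) ℝ) (lmin lmax ε β : ℝ)
    (θstar ψ θ₀ : Vec d) : ℝ :=
  lmin / 2 * (∫ x, |(inner ℝ ψ x : ℝ)| ∂μ) * cosM S (act S θstar) ψ
    - confidence μ S β θ₀ * innerM S (act S θstar) (normalized S θ₀)
    - 2 * lmax * ε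

/-- The term `ρ_υ`; `lmax` is the top eigenvalue of `S`. -/
def rhoUpper (μ : Measure (Vec d)) (S : Matrix (Fin d) (Fin d) ℝ) (lmax ε β : ℝ)
    (θstar ψ θ₀ : Vec d) : ℝ :=
  confidence μ S β θ₀ *
      innerM S (act S (projPerp S θstar (normalized S θ₀))) (normalized S θ₀)
    - lmax / 2 * (∫ x, |(inner ℝ ψ x : ℝ)| ∂μ) * |cosM S (act S (projPerp S θstar θ₀)) ψ|
    - 2 * lmax * ε

/-- The signal term `ρ = (1 - cos_S²(θ*, θ₀)) ρ_ℓ + cos_S(θ*, θ₀) ρ_υ`. -/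
def rho (μ : Measure (Vec d)) (S : Matrix (Fin d) (Fin d) ℝ) (lmin lmax ε β : ℝ)
    (θstar ψ θ₀ : Vec d) : ℝ :=
  (1 - cosM S θstar θ₀ ^ 2) * rhoLower μ S lmin lmax ε β θstar ψ θ₀
    + cosM S θstar θ₀ * rhoUpper μ S lmax ε β θstar ψ θ₀

end WeakToStrong

end

/-! At θ₀ the derivative of θ ↦ cos_Σ(θ, θ*) in the direction -G is -⟨G, Σw⟩/‖θ₀‖_Σ, where w = θ* -
(c/‖θ₀‖_Σ)θ₀ and c is the initial cosine. Let G be the population gradient E[(σ(θ₀ᵀx) - 1[ψᵀx ≥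
0])x]. Ellipticity replaces E[f(vᵀx) uᵀx] by its one-dimensional value along v, with error ε‖u‖_Σ;
taking v = θ₀ and v = ψ evaluates ⟨u, G⟩ (`IsElliptical.abs_inner_popGrad_sub_le`). Since w =
(1-c²)θ* - c Proj θ̃₀, the choices u = Σθ* and u = Σ Proj θ̃₀ give -⟨G, Σw⟩ ≥ ρ
(`IsElliptical.rho_le`).

The population gradient is bounded by √λmax and λmax-Lipschitz, so over a total step length τ = ηT
the iterate moves by -τG(θ₀), up to O(τ²) and a noise term (`norm_sub_init_add_smul_le`). For τ of
order ρ‖θ₀‖/(‖θ₀‖+1)² the second-order losses consume only a fraction of the gain τρ, and the cosine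
grows by order τρ/‖θ₀‖ (`cos_gain`, `cosM_gain`).

The noise increments are pairwise orthogonal in L², so the noise has second moment O(τ²d/B), and
Markov's inequality bounds the probability that it exceeds order τρ
(`IsElliptical.measureReal_sftNoise_le`). -/

noncomputable section

namespace WeakToStrong

/-! ### The form ⟨·,·⟩_S and its spectral bounds -/

section LinearAlgebra
variable {d : ℕ} {S : Matrix (Fin d) (Fin d) ℝ}

lemma act_eq_toEuclideanLin (M : Matrix (Fin d) (Fin d) ℝ) (v : Vec d) :
    act M v = Matrix.toEuclideanLin M v := rfl

lemma innerM_sub_left (M : Matrix (Fin d) (Fin d) ℝ) (x y z : Vec d) :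
    innerM M (x - y) z = innerM M x z - innerM M y z := inner_sub_left _ _ _

lemma innerM_smul_left (M : Matrix (Fin d) (Fin d) ℝ) (c : ℝ) (x y : Vec d) :
    innerM M (c • x) y = c * innerM M x y := real_inner_smul_left _ _ _

lemma act_sub (M : Matrix (Fin d) (Fin d) ℝ) (x y : Vec d) :
    act M (x - y) = act M x - act M y := by
  simp only [act_eq_toEuclideanLin, map_sub]

lemma act_smul (M : Matrix (Fin d) (Fin d) ℝ) (c : ℝ) (x : Vec d) :
    act M (c • x) = c • act M x := by
  simp only [act_eq_toEuclideanLin, map_smul]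

open scoped MatrixOrder in
/-- A positive definite form is the pullback of the Euclidean inner product. -/
lemma exists_innerM_eq_inner (hS : S.PosDef) :
    ∃ L : Vec d →ₗ[ℝ] Vec d, ∀ x y, innerM S x y = inner ℝ (L x) (L y) := by
  obtain ⟨A, hA⟩ := CStarAlgebra.nonneg_iff_eq_star_mul_self.1 hS.posSemidef.nonneg
  refine ⟨Matrix.toEuclideanLin A, fun x y => ?_⟩
  rw [innerM, act_eq_toEuclideanLin, hA, Matrix.star_eq_conjTranspose, ← LinearMap.adjoint_inner_right,
    ← Matrix.toEuclideanLin_conjTranspose_eq_adjoint]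
  congr 1
  simp [Matrix.toEuclideanLin]

lemma innerM_comm (hS : S.PosDef) (x y : Vec d) : innerM S x y = innerM S y x := by
  obtain ⟨L, hL⟩ := exists_innerM_eq_inner hS
  rw [hL, hL, real_inner_comm]

lemma inner_act_left (hS : S.PosDef) (x y : Vec d) : inner ℝ (act S x) y = innerM S x y := by
  rw [real_inner_comm, innerM_comm hS]; rfl

lemma innerM_self_nonneg (hS : S.PosDef) (x : Vec d) : 0 ≤ innerM S x x := by
  obtain ⟨L, hL⟩ := exists_innerM_eq_inner hS
  rw [hL]; exact real_inner_self_nonneg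

lemma normM_nonneg (x : Vec d) : 0 ≤ normM S x := Real.sqrt_nonneg _

lemma normM_sq (hS : S.PosDef) (x : Vec d) : normM S x ^ 2 = innerM S x x :=
  Real.sq_sqrt (innerM_self_nonneg hS x)

lemma normM_smul (hS : S.PosDef) (c : ℝ) (x : Vec d) : normM S (c • x) = |c| * normM S x := by
  rw [normM, innerM_smul_left, innerM_comm hS, innerM_smul_left, ← mul_assoc,
    Real.sqrt_mul (mul_self_nonneg c), Real.sqrt_mul_self_eq_abs, normM]

lemma abs_innerM_le (hS : S.PosDef) (x y : Vec d) :
    |innerM S x y| ≤ normM S x * normM S y := by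
  obtain ⟨L, hL⟩ := exists_innerM_eq_inner hS
  rw [normM, normM, hL, hL, hL, real_inner_self_eq_norm_sq, real_inner_self_eq_norm_sq,
    Real.sqrt_sq (norm_nonneg _), Real.sqrt_sq (norm_nonneg _)]
  exact abs_real_inner_le_norm _ _

/-- Every eigenvalue of `b • 1 - S` has the form b - s with s in the spectrum of S, so this matrix
is positive semidefinite. -/
lemma innerM_self_le (hS : S.PosDef) {b : ℝ} (hb : b ∈ upperBounds (spectrum ℝ S)) (x : Vec d) :
    innerM S x x ≤ b * ‖x‖ ^ 2 := by
  have hH : (b • (1 : Matrix (Fin d) (Fin d) ℝ) - S).IsHermitian :=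
    (Matrix.isHermitian_one.smul (by simp [IsSelfAdjoint])).sub hS.isHermitian
  have h : (b • (1 : Matrix (Fin d) (Fin d) ℝ) - S).PosSemidef := by
    rw [hH.posSemidef_iff_eigenvalues_nonneg]
    intro i
    have h1 := hH.eigenvalues_mem_spectrum_real i
    generalize hH.eigenvalues i = e at h1 ⊢
    rw [← Algebra.algebraMap_eq_smul_one, ← spectrum.singleton_sub_eq] at h1
    obtain ⟨_, rfl, s, hs, h⟩ := h1
    have := hb hs
    simp only [Pi.zero_apply, ge_iff_le]
    rw [← h]; simpa using this
  have := h.dotProduct_mulVec_nonneg x.ofLp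
  simp only [star_trivial, Matrix.sub_mulVec, dotProduct_sub, Matrix.smul_mulVec, Matrix.one_mulVec,
    dotProduct_smul, smul_eq_mul] at this
  rw [EuclideanSpace.real_norm_sq_eq]
  simp only [innerM, act, PiLp.inner_apply, dotProduct] at this ⊢
  simp [pow_two, mul_comm] at this ⊢
  linarith

lemma le_innerM_self (hS : S.PosDef) {b : ℝ} (hb : b ∈ lowerBounds (spectrum ℝ S)) (x : Vec d) :
    b * ‖x‖ ^ 2 ≤ innerM S x x := by
  have hH : (S - b • (1 : Matrix (Fin d) (Fin d) ℝ)).IsHermitian :=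
    hS.isHermitian.sub (Matrix.isHermitian_one.smul (by simp [IsSelfAdjoint]))
  have h : (S - b • (1 : Matrix (Fin d) (Fin d) ℝ)).PosSemidef := by
    rw [hH.posSemidef_iff_eigenvalues_nonneg]
    intro i
    have h1 := hH.eigenvalues_mem_spectrum_real i
    generalize hH.eigenvalues i = e at h1 ⊢
    rw [← Algebra.algebraMap_eq_smul_one, ← spectrum.sub_singleton_eq] at h1
    obtain ⟨s, hs, _, rfl, h⟩ := h1
    have := hb hs
    simp only [Pi.zero_apply, ge_iff_le]
    rw [← h]; simpa using this
  have := h.dotProduct_mulVec_nonneg x.ofLp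
  simp only [star_trivial, Matrix.sub_mulVec, dotProduct_sub, Matrix.smul_mulVec, Matrix.one_mulVec,
    dotProduct_smul, smul_eq_mul] at this
  rw [EuclideanSpace.real_norm_sq_eq]
  simp only [innerM, act, PiLp.inner_apply, dotProduct] at this ⊢
  simp [pow_two, mul_comm] at this ⊢
  linarith

lemma normM_le (hS : S.PosDef) {b : ℝ} (hb : b ∈ upperBounds (spectrum ℝ S)) (x : Vec d) :
    normM S x ≤ √b * ‖x‖ := by
  rw [normM, ← Real.sqrt_sq (norm_nonneg x), ← Real.sqrt_mul' _ (sq_nonneg _)]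
  exact Real.sqrt_le_sqrt (innerM_self_le hS hb x)

lemma le_normM (hS : S.PosDef) {b : ℝ} (hb : b ∈ lowerBounds (spectrum ℝ S)) (x : Vec d) :
    √b * ‖x‖ ≤ normM S x := by
  rw [normM, ← Real.sqrt_sq (norm_nonneg x), ← Real.sqrt_mul' _ (sq_nonneg _)]
  exact Real.sqrt_le_sqrt (le_innerM_self hS hb x)

/-- ‖Sx‖² = ⟨x, Sx⟩_S ≤ ‖x‖_S ‖Sx‖_S ≤ ‖x‖_S √b ‖Sx‖; divide by ‖Sx‖. -/
lemma norm_act_le (hS : S.PosDef) {b : ℝ} (hb : b ∈ upperBounds (spectrum ℝ S)) (x : Vec d) :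
    ‖act S x‖ ≤ √b * normM S x := by
  rcases (norm_nonneg (act S x)).eq_or_lt with h | h
  · rw [← h]; exact mul_nonneg (Real.sqrt_nonneg _) (normM_nonneg _)
  · have h1 : ‖act S x‖ ^ 2 = innerM S x (act S x) := by
      rw [← real_inner_self_eq_norm_sq, inner_act_left hS]
    have h2 := (le_abs_self _).trans (abs_innerM_le hS x (act S x))
    have h3 := normM_le hS hb (act S x)
    have h4 := mul_le_mul_of_nonneg_left h3 (normM_nonneg (S := S) x)
    refine le_of_mul_le_mul_right ?_ h
    nlinarith

lemma normM_act_le (hS : S.PosDef) {b : ℝ} (hb0 : 0 ≤ b) (hb : b ∈ upperBounds (spectrum ℝ S))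
    (x : Vec d) : normM S (act S x) ≤ b * normM S x := by
  calc normM S (act S x) ≤ √b * ‖act S x‖ := normM_le hS hb _
    _ ≤ √b * (√b * normM S x) := by gcongr; exact norm_act_le hS hb x
    _ = b * normM S x := by rw [← mul_assoc, Real.mul_self_sqrt hb0]

/-- From ‖x‖_S² = ⟨x, Sx⟩ ≤ ‖x‖‖Sx‖ and √b‖x‖ ≤ ‖x‖_S one gets √b‖x‖_S ≤ ‖Sx‖; a second factor √b
comes from `le_normM`. -/
lemma le_normM_act (hS : S.PosDef) {b : ℝ} (hb0 : 0 ≤ b) (hb : b ∈ lowerBounds (spectrum ℝ S))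
    (x : Vec d) : b * normM S x ≤ normM S (act S x) := by
  have h0 : √b * normM S x ≤ ‖act S x‖ := by
    rcases (normM_nonneg (S := S) x).eq_or_lt with h | h
    · rw [← h]; simp
    · have h1 : normM S x ^ 2 ≤ ‖x‖ * ‖act S x‖ := by
        rw [normM_sq hS]; exact real_inner_le_norm _ _
      have h2 := le_normM hS hb x
      refine le_of_mul_le_mul_right ?_ h
      have := mul_le_mul_of_nonneg_right h2 (norm_nonneg (act S x))
      nlinarith [mul_le_mul_of_nonneg_left h1 (Real.sqrt_nonneg b)]
  calc b * normM S x = √b * (√b * normM S x) := by rw [← mul_assoc, Real.mul_self_sqrt hb0]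
    _ ≤ √b * ‖act S x‖ := by gcongr
    _ ≤ _ := le_normM hS hb _

lemma normM_pos (hS : S.PosDef) {x : Vec d} (hx : x ≠ 0) : 0 < normM S x := by
  refine Real.sqrt_pos.2 ?_
  have := hS.dotProduct_mulVec_pos (x := x.ofLp) (by simpa using hx)
  simp only [innerM, act, PiLp.inner_apply, dotProduct] at this ⊢
  simpa [mul_comm] using this

/-- Turns the sign condition on ⟨θ*, ψ⟩_{Σ²} into one on the numerator of cos_Σ(Σθ*, ψ). -/
lemma innerM_sq (hS : S.PosDef) (x y : Vec d) : innerM (S ^ 2) x y = innerM S (act S x) y := by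
  have h : act (S ^ 2) y = act S (act S y) := by
    simp [act, pow_two, Matrix.mulVec_mulVec]
  rw [innerM, h]
  exact (inner_act_left hS x (act S y)).symm

end LinearAlgebra

/-! ### First-order growth of a cosine -/

section Cosine
variable {E : Type*} [NormedAddCommGroup E] [InnerProductSpace ℝ E]

/-- A first-order lower bound for the change of a cosine under a perturbation. -/
lemma cos_gain {a e D : E} {c s : ℝ} (ha : a ≠ 0) (hc0 : 0 ≤ c) (hc1 : c ≤ 1)
    (hc : inner ℝ a e = c * ‖a‖) (hD : ‖D‖ ≤ ‖a‖ / 2) (hs : 0 ≤ s)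
    (h : s ≤ inner ℝ D (e - (c / ‖a‖) • a) - ‖D‖ ^ 2 / (2 * ‖a‖)) :
    s / (2 * ‖a‖) ≤ inner ℝ (a + D) e / ‖a + D‖ - c := by
  have hna : 0 < ‖a‖ := norm_pos_iff.2 ha
  have hb2 : ‖a + D‖ ≤ 2 * ‖a‖ := (norm_add_le _ _).trans (by linarith)
  have hb0 : 0 < ‖a + D‖ := by
    have := norm_sub_le (a + D) D
    rw [add_sub_cancel_right] at this
    linarith
  -- AM-GM, ‖a + D‖ ≤ (‖a‖² + ‖a + D‖²)/(2‖a‖): the norm linearized at a, with an explicit quadratic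
  -- error.
  have hnorm : ‖a + D‖ ≤ ‖a‖ + inner ℝ D a / ‖a‖ + ‖D‖ ^ 2 / (2 * ‖a‖) := by
    have h1 : ‖a + D‖ ^ 2 = ‖a‖ ^ 2 + 2 * inner ℝ D a + ‖D‖ ^ 2 := by
      rw [norm_add_sq_real, real_inner_comm]
    have h2 : ‖a‖ + inner ℝ D a / ‖a‖ + ‖D‖ ^ 2 / (2 * ‖a‖) = (‖a‖ ^ 2 + ‖a + D‖ ^ 2) / (2 * ‖a‖) := by
      rw [h1]; field_simp; ring
    rw [h2, le_div_iff₀ (by positivity)]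
    nlinarith [sq_nonneg (‖a‖ - ‖a + D‖)]
  rw [inner_sub_right, inner_smul_right] at h
  have hgain : s ≤ inner ℝ (a + D) e - c * ‖a + D‖ := by
    rw [inner_add_left, hc]
    have h3 := mul_le_mul_of_nonneg_left hnorm hc0
    have h4 : c * (‖D‖ ^ 2 / (2 * ‖a‖)) ≤ ‖D‖ ^ 2 / (2 * ‖a‖) :=
      mul_le_of_le_one_left (by positivity) hc1
    have h5 : c / ‖a‖ * inner ℝ D a = c * (inner ℝ D a / ‖a‖) := by ring
    rw [h5] at h
    linarith
  calc s / (2 * ‖a‖) ≤ s / ‖a + D‖ := by gcongr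
    _ ≤ (inner ℝ (a + D) e - c * ‖a + D‖) / ‖a + D‖ := by gcongr
    _ = _ := by field_simp

end Cosine

/-! ### The logistic function -/

section Logistic

lemma logistic_pos (r : ℝ) : 0 < logistic 1 r := by
  unfold logistic; positivity

lemma logistic_lt_one (r : ℝ) : logistic 1 r < 1 := by
  unfold logistic
  rw [div_lt_one (by positivity)]
  linarith [Real.exp_pos (-1 * r)]

lemma hasDerivAt_logistic (r : ℝ) :
    HasDerivAt (logistic 1) (logistic 1 r * (1 - logistic 1 r)) r := by
  have h1 : HasDerivAt (fun r : ℝ => 1 + Real.exp (-1 * r)) (Real.exp (-1 * r) * (-1)) r := by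
    have := ((hasDerivAt_id r).const_mul (-1 : ℝ)).exp.const_add 1
    simpa using this
  have h2 := h1.inv (by positivity)
  have h3 : logistic 1 = (fun r : ℝ => 1 + Real.exp (-1 * r))⁻¹ := by
    funext r; simp [logistic]
  rw [← h3] at h2
  refine h2.congr_deriv ?_
  have : 0 < 1 + Real.exp (-1 * r) := by positivity
  unfold logistic
  field_simp
  ring

lemma continuous_logistic : Continuous (logistic 1) :=
  continuous_iff_continuousAt.2 fun r => (hasDerivAt_logistic r).continuousAt

/-- The derivative σ(1 - σ) lies in (0, 1); the sharper constant 1/4 would only change constants. -/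
lemma abs_logistic_sub_le (r s : ℝ) : |logistic 1 r - logistic 1 s| ≤ |r - s| := by
  have h := Convex.norm_image_sub_le_of_norm_hasDerivWithin_le (f := logistic 1) (C := 1)
    (s := Set.univ) (fun x _ => (hasDerivAt_logistic x).hasDerivWithinAt)
    (fun x _ => ?_) convex_univ (Set.mem_univ s) (Set.mem_univ r)
  · simpa using h
  · rw [Real.norm_eq_abs, abs_le]
    constructor <;> nlinarith [logistic_pos x, logistic_lt_one x]

end Logistic

/-! ### Gradient of the loss at one sample -/

section SampleGradient
variable {d : ℕ}

/-- The residual `σ(θᵀx) - 𝟙(ψᵀx ≥ 0)`. -/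
def residual (ψ θ x : Vec d) : ℝ :=
  logistic 1 (inner ℝ θ x) - if 0 ≤ (inner ℝ ψ x : ℝ) then 1 else 0

/-- The gradient of the pseudo-labelled logistic loss at a single sample. -/
def sampleGrad (ψ θ x : Vec d) : Vec d := residual ψ θ x • x

lemma abs_residual_le (ψ θ x : Vec d) : |residual ψ θ x| ≤ 1 := by
  have h1 := logistic_pos (inner ℝ θ x)
  have h2 := logistic_lt_one (inner ℝ θ x)
  unfold residual
  rw [abs_le]
  split_ifs <;> constructor <;> linarith

lemma norm_sampleGrad_le (ψ θ x : Vec d) : ‖sampleGrad ψ θ x‖ ≤ ‖x‖ := by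
  rw [sampleGrad, norm_smul]
  exact mul_le_of_le_one_left (norm_nonneg _) (abs_residual_le ψ θ x)

lemma measurable_residual (ψ : Vec d) {α : Type*} [MeasurableSpace α] {f g : α → Vec d}
    (hf : Measurable f) (hg : Measurable g) : Measurable fun a => residual ψ (f a) (g a) := by
  unfold residual
  refine (continuous_logistic.measurable.comp (by fun_prop)).sub ?_
  refine Measurable.ite ?_ measurable_const measurable_const
  exact measurableSet_le measurable_const (by fun_prop)

lemma measurable_sampleGrad (ψ : Vec d) {α : Type*} [MeasurableSpace α] {f g : α → Vec d}
    (hf : Measurable f) (hg : Measurable g) : Measurable fun a => sampleGrad ψ (f a) (g a) :=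
  (measurable_residual ψ hf hg).smul hg

/-- Because σ' = σ(1 - σ), the derivatives of -log σ and -log(1 - σ) are σ - 1 and σ, which is σ
minus the label in both cases; the chain rule contributes the factor x. -/
lemma gradient_logisticLoss (ψ θ x : Vec d) :
    gradient (fun φ : Vec d => logisticLoss 1 φ x (pseudoLabel ψ x)) θ = sampleGrad ψ θ x := by
  have hin : HasFDerivAt (fun φ : Vec d => (inner ℝ φ x : ℝ)) (innerSL ℝ x) θ := by
    have := (innerSL ℝ x).hasFDerivAt (x := θ)
    refine this.congr_of_eventuallyEq (Filter.Eventually.of_forall fun φ => ?_)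
    simp [real_inner_comm]
  have key : ∀ (f : ℝ → ℝ) (f' : ℝ), HasDerivAt f f' (inner ℝ θ x) →
      HasGradientAt (fun φ : Vec d => f (inner ℝ φ x)) (f' • x) θ := by
    intro f f' hf
    have h := hf.comp_hasFDerivAt θ hin
    have e : (InnerProductSpace.toDual ℝ (Vec d)) (f' • x) = f' • innerSL ℝ x := by
      ext v; simp
    rw [hasGradientAt_iff_hasFDerivAt, e]
    exact h
  apply HasGradientAt.gradient
  unfold sampleGrad residual logisticLoss likelihood pseudoLabel
  have h1 := logistic_pos (inner ℝ θ x)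
  have h2 := logistic_lt_one (inner ℝ θ x)
  by_cases h : 0 ≤ (inner ℝ ψ x : ℝ)
  · simp only [h, if_true]
    refine key (fun r => -Real.log (logistic 1 r)) _ ?_
    refine ((hasDerivAt_logistic _).log h1.ne').neg.congr_deriv ?_
    rw [mul_div_cancel_left₀ _ h1.ne', neg_sub]
  · simp only [h, if_false, zero_ne_one]
    refine key (fun r => -Real.log (1 - logistic 1 r)) _ ?_
    have h3 : 1 - logistic 1 (inner ℝ θ x) ≠ 0 := by linarith
    refine (((hasDerivAt_logistic _).const_sub 1).log h3).neg.congr_deriv ?_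
    rw [neg_div, neg_neg, mul_div_cancel_right₀ _ h3, sub_zero]

lemma batchGradient_eq (ψ : Vec d) {B : ℕ} (x : Fin B → Vec d) (θ : Vec d) :
    batchGradient 1 ψ x θ = (1 / (B : ℝ)) • ∑ i, sampleGrad ψ θ (x i) := by
  simp only [batchGradient, gradient_logisticLoss]

end SampleGradient

/-! ### Second moments of linear forms -/

section Moments
variable {d : ℕ} {μ : Measure (Vec d)} {S : Matrix (Fin d) (Fin d) ℝ}
  {ε : ℝ} {E : Submodule ℝ (Vec d)}

lemma IsElliptical.memLp_inner (h : IsElliptical μ S ε E) (u : Vec d) :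
    MemLp (fun x : Vec d => (inner ℝ u x : ℝ)) 2 μ :=
  h.memLp_two.const_inner u

lemma integral_abs_mul_le {X Y : Vec d → ℝ} (hX : MemLp X 2 μ) (hY : MemLp Y 2 μ) :
    ∫ x, |X x| * |Y x| ∂μ ≤ √(∫ x, X x ^ 2 ∂μ) * √(∫ x, Y x ^ 2 ∂μ) := by
  have := integral_mul_norm_le_Lp_mul_Lq (μ := μ) (f := X) (g := Y) Real.HolderConjugate.two_two
    (by simpa using hX) (by simpa using hY)
  simpa [Real.sqrt_eq_rpow] using this

variable [IsProbabilityMeasure μ]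

lemma IsElliptical.integrable_inner (h : IsElliptical μ S ε E) (u : Vec d) :
    Integrable (fun x : Vec d => (inner ℝ u x : ℝ)) μ :=
  (h.memLp_inner u).integrable (by norm_num)

lemma IsElliptical.integrable (h : IsElliptical μ S ε E) :
    Integrable (fun x : Vec d => x) μ :=
  h.memLp_two.integrable (by norm_num)

lemma IsElliptical.integral_inner (h : IsElliptical μ S ε E) (u : Vec d) :
    ∫ x, (inner ℝ u x : ℝ) ∂μ = 0 := by
  rw [_root_.integral_inner h.integrable, h.mean_zero, inner_zero_right]

lemma inner_single_one (i : Fin d) (x : Vec d) :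
    inner ℝ (EuclideanSpace.single i (1 : ℝ)) x = x i := by
  rw [EuclideanSpace.inner_single_left]; simp

lemma IsElliptical.integral_mul (h : IsElliptical μ S ε E) (i j : Fin d) :
    ∫ x : Vec d, x i * x j ∂μ = S i j := by
  have hi := h.memLp_inner (EuclideanSpace.single i 1)
  have hj := h.memLp_inner (EuclideanSpace.single j 1)
  have mi := h.integral_inner (EuclideanSpace.single i 1)
  simp only [inner_single_one] at hi hj mi
  have := h.covariance_eq i j
  rw [covariance_eq_sub hi hj, mi] at this
  simpa using this

lemma IsElliptical.integral_inner_mul_inner (h : IsElliptical μ S ε E) (u v : Vec d) :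
    ∫ x : Vec d, (inner ℝ u x : ℝ) * inner ℝ v x ∂μ = innerM S u v := by
  have hi (i : Fin d) := h.memLp_inner (EuclideanSpace.single i 1)
  simp only [inner_single_one] at hi
  have hint (i j : Fin d) : Integrable (fun x : Vec d => x i * u i * (x j * v j)) μ := by
    have := ((hi i).integrable_mul (hi j)).const_mul (u i * v j)
    refine this.congr (Filter.Eventually.of_forall fun x => ?_)
    simp only [Pi.mul_apply]; ring
  simp only [PiLp.inner_apply, RCLike.inner_apply, conj_trivial, Finset.sum_mul_sum]
  rw [integral_finsetSum _ fun i _ => integrable_finsetSum _ fun j _ => hint i j]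
  simp only [innerM, act, PiLp.inner_apply, RCLike.inner_apply, conj_trivial, Matrix.mulVec,
    dotProduct, Finset.sum_mul]
  refine Finset.sum_congr rfl fun i _ => ?_
  rw [integral_finsetSum _ fun j _ => hint i j]
  refine Finset.sum_congr rfl fun j _ => ?_
  rw [← h.integral_mul i j, ← integral_mul_const, ← integral_mul_const]
  refine integral_congr_ae (Filter.Eventually.of_forall fun x => ?_)
  simp only; ring

/-- The second moment is the trace of S, and each diagonal entry is at most b. This is where the
dimension enters the failure probability. -/
lemma IsElliptical.integral_norm_sq_le (h : IsElliptical μ S ε E) {b : ℝ}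
    (hb : b ∈ upperBounds (spectrum ℝ S)) : ∫ x : Vec d, ‖x‖ ^ 2 ∂μ ≤ d * b := by
  have hi (i : Fin d) := h.memLp_inner (EuclideanSpace.single i 1)
  simp only [EuclideanSpace.real_norm_sq_eq]
  simp only [inner_single_one] at hi
  rw [integral_finsetSum _ fun i _ => (hi i).integrable_sq]
  calc ∑ i : Fin d, ∫ x : Vec d, x i ^ 2 ∂μ ≤ ∑ i : Fin d, b := by
        refine Finset.sum_le_sum fun i _ => ?_
        have h1 := h.integral_inner_mul_inner (EuclideanSpace.single i 1) (EuclideanSpace.single i 1)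
        have h2 := innerM_self_le h.posDef hb (EuclideanSpace.single i 1)
        simp only [inner_single_one, ← pow_two] at h1
        rw [h1]
        simpa using h2
    _ = d * b := by simp

lemma IsElliptical.integral_abs_inner_mul_le (h : IsElliptical μ S ε E) (u v : Vec d) :
    ∫ x : Vec d, |(inner ℝ u x : ℝ)| * |inner ℝ v x| ∂μ ≤ normM S u * normM S v := by
  refine (integral_abs_mul_le (h.memLp_inner u) (h.memLp_inner v)).trans_eq ?_
  simp only [pow_two, h.integral_inner_mul_inner]
  rfl

lemma IsElliptical.integral_abs_inner_le (h : IsElliptical μ S ε E) (u : Vec d) :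
    ∫ x : Vec d, |(inner ℝ u x : ℝ)| ∂μ ≤ normM S u := by
  have := integral_abs_mul_le (h.memLp_inner u) (memLp_const (1 : ℝ) (μ := μ))
  simp only [pow_two, h.integral_inner_mul_inner] at this
  simpa [normM] using this

end Moments

/-! ### Ellipticity and the population gradient -/

/-- A bound on a conditional expectation bounds the integral against functions of modulus at most
one that are measurable with respect to the conditioning. -/
lemma abs_integral_mul_le_of_abs_condExp_le {Ω : Type*} {m m₀ : MeasurableSpace Ω} {μ : Measure Ω}
    [IsProbabilityMeasure μ] (hm : m ≤ m₀) {f g : Ω → ℝ} {C : ℝ} (hf : StronglyMeasurable[m] f)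
    (hf1 : ∀ x, |f x| ≤ 1) (hg : Integrable g μ) (hC : ∀ᵐ x ∂μ, |condExp m μ g x| ≤ C) :
    |∫ x, f x * g x ∂μ| ≤ C := by
  have hpull := condExp_stronglyMeasurable_mul_of_bound hm hf hg 1 (Filter.Eventually.of_forall hf1)
  have hint : ∫ x, f x * g x ∂μ = ∫ x, f x * condExp m μ g x ∂μ := by
    have h := integral_condExp hm (μ := μ) (f := f * g)
    exact h.symm.trans (integral_congr_ae hpull)
  rw [hint, ← Real.norm_eq_abs]
  refine (norm_integral_le_of_norm_le_const (C := C) ?_).trans_eq (by simp)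
  filter_upwards [hC] with x hx
  rw [norm_mul]
  exact (mul_le_of_le_one_left (norm_nonneg _) (hf1 _)).trans hx

section PopulationGradient
variable {d : ℕ} {μ : Measure (Vec d)} [IsProbabilityMeasure μ] {S : Matrix (Fin d) (Fin d) ℝ}
  {ε b : ℝ} {E : Submodule ℝ (Vec d)}

/-- Multiplication by a bounded measurable function preserves integrability of linear forms. -/
lemma IsElliptical.integrable_mul_inner (h : IsElliptical μ S ε E) {f : Vec d → ℝ}
    (hf : Measurable f) (hf1 : ∀ x, |f x| ≤ 1) (u : Vec d) :
    Integrable (fun x => f x * inner ℝ u x) μ :=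
  (h.integrable_inner u).bdd_mul hf.aestronglyMeasurable
    (Filter.Eventually.of_forall hf1)

lemma IsElliptical.abs_integral_mul_inner_le_of_orthogonal (h : IsElliptical μ S ε E)
    {u v : Vec d} (hv : v ∈ E) (hv0 : v ≠ 0) (huv : innerM S u v = 0) {f : ℝ → ℝ}
    (hf : Measurable f) (hf1 : ∀ r, |f r| ≤ 1) :
    |∫ x, f (inner ℝ v x) * inner ℝ u x ∂μ| ≤ ε * normM S u := by
  have hmeas : Measurable (fun x : Vec d => (inner ℝ v x : ℝ)) := by fun_prop
  refine abs_integral_mul_le_of_abs_condExp_le ?_ ?_ (fun x => hf1 _) (h.integrable_inner u)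
    (h.condExp_le v hv hv0 u huv)
  · rw [← BorelSpace.measurable_eq]; exact hmeas.comap_le
  · rw [← BorelSpace.measurable_eq (α := ℝ)]
    exact (hf.comp (comap_measurable _)).stronglyMeasurable

/-- Split u = a v + (u - a v) orthogonally for ⟨·,·⟩_S. Only the second summand meets the
ellipticity error, and by Pythagoras its norm is at most ‖u‖_S. -/
lemma IsElliptical.abs_integral_mul_inner_sub_le (h : IsElliptical μ S ε E) (hε : 0 ≤ ε)
    {v : Vec d} (hv : v ∈ E) (hv0 : v ≠ 0) (u : Vec d) {f : ℝ → ℝ}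
    (hf : Measurable f) (hf1 : ∀ r, |f r| ≤ 1) :
    |∫ x, f (inner ℝ v x) * inner ℝ u x ∂μ
      - innerM S u v / innerM S v v * ∫ x, f (inner ℝ v x) * inner ℝ v x ∂μ|
      ≤ ε * normM S u := by
  set a := innerM S u v / innerM S v v with ha
  have hvv : 0 < innerM S v v := by
    rw [← normM_sq h.posDef]; exact pow_pos (normM_pos h.posDef hv0) 2
  have hav : a * innerM S v v = innerM S u v := by rw [ha]; field_simp
  have horth : innerM S (u - a • v) v = 0 := by
    rw [innerM_sub_left, innerM_smul_left, hav, sub_self]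
  have hnorm : normM S (u - a • v) ≤ normM S u := by
    refine Real.sqrt_le_sqrt ?_
    have h1 : innerM S (u - a • v) (u - a • v) = innerM S u u - a ^ 2 * innerM S v v := by
      rw [innerM_comm h.posDef, innerM_sub_left, innerM_smul_left, innerM_comm h.posDef v,
        horth, innerM_comm h.posDef u, innerM_sub_left, innerM_smul_left, innerM_comm h.posDef v u,
        ← hav]
      ring
    rw [h1]
    nlinarith [mul_nonneg (sq_nonneg a) hvv.le]
  have hm : Measurable fun x : Vec d => f (inner ℝ v x) := hf.comp (by fun_prop)
  have key := h.abs_integral_mul_inner_le_of_orthogonal hv hv0 horth hf hf1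
  have hsplit : ∫ x, f (inner ℝ v x) * inner ℝ (u - a • v) x ∂μ
      = ∫ x, f (inner ℝ v x) * inner ℝ u x ∂μ - a * ∫ x, f (inner ℝ v x) * inner ℝ v x ∂μ := by
    rw [← integral_const_mul, ← integral_sub (h.integrable_mul_inner hm (fun _ => hf1 _) u)
      ((h.integrable_mul_inner hm (fun _ => hf1 _) v).const_mul a)]
    refine integral_congr_ae (Filter.Eventually.of_forall fun x => ?_)
    simp only [inner_sub_left, real_inner_smul_left]; ring
  rw [← hsplit]
  exact key.trans (mul_le_mul_of_nonneg_left hnorm hε)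

/-- 1[r ≥ 0] r = (|r| + r)/2, and the linear part has mean zero. -/
lemma IsElliptical.integral_indicator_mul_inner (h : IsElliptical μ S ε E) (v : Vec d) :
    ∫ x, (if 0 ≤ (inner ℝ v x : ℝ) then (1 : ℝ) else 0) * inner ℝ v x ∂μ
      = (∫ x, |(inner ℝ v x : ℝ)| ∂μ) / 2 := by
  have h1 : ∀ x : Vec d, (if 0 ≤ (inner ℝ v x : ℝ) then (1 : ℝ) else 0) * inner ℝ v x
      = (|(inner ℝ v x : ℝ)| + inner ℝ v x) / 2 := by
    intro x
    split_ifs with hx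
    · rw [abs_of_nonneg hx]; ring
    · rw [abs_of_neg (not_le.1 hx)]; ring
  simp only [h1]
  rw [integral_div, integral_add (h.integrable_inner v).abs (h.integrable_inner v),
    h.integral_inner, add_zero]

/-- The population gradient of the pseudo-labelled logistic loss. -/
def popGrad (ψ : Vec d) (μ : Measure (Vec d)) (θ : Vec d) : Vec d := ∫ x, sampleGrad ψ θ x ∂μ

lemma IsElliptical.integrable_sampleGrad (h : IsElliptical μ S ε E) (ψ θ : Vec d) :
    Integrable (sampleGrad ψ θ) μ :=
  h.integrable.norm.mono' (measurable_sampleGrad ψ measurable_const measurable_id).aestronglyMeasurable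
    (Filter.Eventually.of_forall fun x => norm_sampleGrad_le ψ θ x)

lemma IsElliptical.inner_popGrad (h : IsElliptical μ S ε E) (ψ θ u : Vec d) :
    inner ℝ u (popGrad ψ μ θ) = ∫ x, residual ψ θ x * inner ℝ u x ∂μ := by
  rw [popGrad, ← _root_.integral_inner (h.integrable_sampleGrad ψ θ)]
  simp only [sampleGrad, inner_smul_right]

lemma norm_le_of_forall_inner_le {F : Type*} [NormedAddCommGroup F] [InnerProductSpace ℝ F]
    {g : F} {C : ℝ} (hC : 0 ≤ C) (h : inner ℝ g g ≤ C * ‖g‖) : ‖g‖ ≤ C := by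
  rcases (norm_nonneg g).eq_or_lt with h0 | h0
  · rwa [← h0]
  · rw [real_inner_self_eq_norm_sq, pow_two] at h
    exact le_of_mul_le_mul_right h h0

/-- Testing g against itself keeps the bound dimension-free: ‖g‖² ≤ E|gᵀx| ≤ ‖g‖_S ≤ √b‖g‖. -/
lemma IsElliptical.norm_popGrad_le (h : IsElliptical μ S ε E)
    (hb : b ∈ upperBounds (spectrum ℝ S)) (ψ θ : Vec d) : ‖popGrad ψ μ θ‖ ≤ √b := by
  refine norm_le_of_forall_inner_le (Real.sqrt_nonneg b) ?_
  set g := popGrad ψ μ θ with hg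
  calc inner ℝ g g = ∫ x, residual ψ θ x * inner ℝ g x ∂μ := h.inner_popGrad ψ θ g
    _ ≤ ∫ x, |(inner ℝ g x : ℝ)| ∂μ := by
        refine integral_mono (h.integrable_mul_inner (measurable_residual ψ measurable_const measurable_id)
          (abs_residual_le ψ θ) g) (h.integrable_inner g).abs fun x => ?_
        refine (le_abs_self _).trans ?_
        rw [abs_mul]
        exact mul_le_of_le_one_left (abs_nonneg _) (abs_residual_le ψ θ x)
    _ ≤ normM S g := h.integral_abs_inner_le g
    _ ≤ √b * ‖g‖ := normM_le h.posDef hb g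

/-- Again tested against the difference itself: the teacher labels cancel, σ is 1-Lipschitz, and
Cauchy–Schwarz gives two factors √b. -/
lemma IsElliptical.norm_popGrad_sub_le (h : IsElliptical μ S ε E) (hb0 : 0 ≤ b)
    (hb : b ∈ upperBounds (spectrum ℝ S)) (ψ θ θ' : Vec d) :
    ‖popGrad ψ μ θ - popGrad ψ μ θ'‖ ≤ b * ‖θ - θ'‖ := by
  refine norm_le_of_forall_inner_le (by positivity) ?_
  set g := popGrad ψ μ θ - popGrad ψ μ θ' with hg
  have hi (φ : Vec d) := h.integrable_mul_inner (f := residual ψ φ)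
    (measurable_residual ψ measurable_const measurable_id)
    (abs_residual_le ψ φ) g
  calc inner ℝ g g
      = ∫ x, (residual ψ θ x * inner ℝ g x - residual ψ θ' x * inner ℝ g x) ∂μ := by
        rw [integral_sub (hi θ) (hi θ'), ← h.inner_popGrad, ← h.inner_popGrad, ← inner_sub_right]
    _ ≤ ∫ x, |(inner ℝ (θ - θ') x : ℝ)| * |(inner ℝ g x : ℝ)| ∂μ := by
        refine integral_mono ((hi θ).sub (hi θ'))
          ((h.memLp_inner (θ - θ')).abs.integrable_mul (h.memLp_inner g).abs) fun x => ?_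
        simp only
        rw [← sub_mul]
        refine (le_abs_self _).trans ?_
        rw [abs_mul]
        refine mul_le_mul_of_nonneg_right ?_ (abs_nonneg _)
        unfold residual
        rw [sub_sub_sub_cancel_right, inner_sub_left]
        exact abs_logistic_sub_le _ _
    _ ≤ normM S (θ - θ') * normM S g := h.integral_abs_inner_mul_le _ _
    _ ≤ (√b * ‖θ - θ'‖) * (√b * ‖g‖) := by
        gcongr
        · exact normM_nonneg _
        · exact normM_le h.posDef hb _
        · exact normM_le h.posDef hb _
    _ = b * ‖θ - θ'‖ * ‖g‖ := by
        nth_rewrite 3 [← Real.mul_self_sqrt hb0]; ring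

/-- The population gradient in the direction `u`, up to the ellipticity error. -/
lemma IsElliptical.abs_inner_popGrad_sub_le {ψ θ₀ : Vec d}
    (h : IsElliptical μ S ε (Submodule.span ℝ {ψ, θ₀})) (hε : 0 ≤ ε) (hψ : normM S ψ = 1)
    (hθ : θ₀ ≠ 0) (u : Vec d) :
    |inner ℝ u (popGrad ψ μ θ₀)
      - (confidence μ S 1 θ₀ * innerM S u (normalized S θ₀)
        - innerM S u ψ * ((∫ x, |(inner ℝ ψ x : ℝ)| ∂μ) / 2))| ≤ 2 * (ε * normM S u) := by
  have hψ0 : ψ ≠ 0 := by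
    rintro rfl
    simp [normM, innerM] at hψ
  have hψψ : innerM S ψ ψ = 1 := by rw [← normM_sq h.posDef, hψ, one_pow]
  have hθpos := normM_pos h.posDef hθ
  have hstep : Measurable fun r : ℝ => if 0 ≤ r then (1 : ℝ) else 0 :=
    Measurable.ite measurableSet_Ici measurable_const measurable_const
  have hstep1 : ∀ r : ℝ, |if 0 ≤ r then (1 : ℝ) else 0| ≤ 1 := by
    intro r; split_ifs <;> simp
  have hlog1 : ∀ r : ℝ, |logistic 1 r| ≤ 1 := fun r => by
    rw [abs_of_pos (logistic_pos r)]; exact (logistic_lt_one r).le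
  -- One ellipticity error for the teacher's step function along ψ and one for the student's
  -- logistic function along θ₀: hence the factor 2.
  have h1 := h.abs_integral_mul_inner_sub_le hε (Submodule.subset_span (by simp)) hψ0 u hstep hstep1
  have h2 := h.abs_integral_mul_inner_sub_le hε (Submodule.subset_span (by simp)) hθ u
    continuous_logistic.measurable hlog1
  rw [hψψ, div_one, h.integral_indicator_mul_inner] at h1
  have hc : innerM S u θ₀ / innerM S θ₀ θ₀ * ∫ x, logistic 1 (inner ℝ θ₀ x) * inner ℝ θ₀ x ∂μ
      = confidence μ S 1 θ₀ * innerM S u (normalized S θ₀) := by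
    rw [confidence, normalized, innerM_comm h.posDef u ((1 / normM S θ₀) • θ₀), innerM_smul_left,
      innerM_comm h.posDef θ₀ u, ← normM_sq h.posDef]
    field_simp
  rw [hc] at h2
  have hsplit : inner ℝ u (popGrad ψ μ θ₀) = ∫ x, logistic 1 (inner ℝ θ₀ x) * inner ℝ u x ∂μ
      - ∫ x, (if 0 ≤ (inner ℝ ψ x : ℝ) then (1 : ℝ) else 0) * inner ℝ u x ∂μ := by
    rw [h.inner_popGrad, ← integral_sub]
    · simp only [residual, sub_mul]
    · exact h.integrable_mul_inner (continuous_logistic.measurable.comp (by fun_prop))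
        (fun _ => hlog1 _) u
    · exact h.integrable_mul_inner
        (f := fun x => if 0 ≤ (inner ℝ ψ x : ℝ) then (1 : ℝ) else 0)
        (hstep.comp (by fun_prop)) (fun _ => hstep1 _) u
  rw [hsplit]
  rw [abs_le] at *
  constructor <;> linarith

/-- The signal `ρ` bounds the directional derivative of the cosine along the negative population
gradient from below. -/
lemma IsElliptical.rho_le {lmin lmax : ℝ} {θstar ψ θ₀ : Vec d}
    (h : IsElliptical μ S ε (Submodule.span ℝ {ψ, θ₀})) (hε : 0 ≤ ε) (hlmin : 0 ≤ lmin)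
    (hmin : lmin ∈ lowerBounds (spectrum ℝ S)) (hlmax : 0 ≤ lmax)
    (hmax : lmax ∈ upperBounds (spectrum ℝ S))
    (hstar : normM S θstar = 1) (hψ : normM S ψ = 1) (hθ : θ₀ ≠ 0)
    (hθ₀ : 0 ≤ innerM S θstar θ₀) (hsψ : 0 ≤ innerM (S ^ 2) θstar ψ) :
    rho μ S lmin lmax ε 1 θstar ψ θ₀
      ≤ - inner ℝ (popGrad ψ μ θ₀)
          (act S (θstar - (cosM S θstar θ₀ / normM S θ₀) • θ₀)) := by
  have hS := h.posDef
  set G := popGrad ψ μ θ₀ with hG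
  set A := ∫ x, |(inner ℝ ψ x : ℝ)| ∂μ with hA
  have hA0 : 0 ≤ A := integral_nonneg fun _ => abs_nonneg _
  set c := cosM S θstar θ₀ with hc
  have hθpos := normM_pos hS hθ
  have hc0 : 0 ≤ c := div_nonneg hθ₀ (mul_nonneg (normM_nonneg _) (normM_nonneg _))
  have hc1 : c ≤ 1 := by
    rw [hc, cosM, div_le_one (by rw [hstar]; simpa using hθpos)]
    exact (le_abs_self _).trans (abs_innerM_le hS _ _)
  have hss : innerM S θstar θstar = 1 := by rw [← normM_sq hS, hstar, one_pow]
  have hcn : innerM S θstar (normalized S θ₀) = c := by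
    rw [hc, normalized, innerM_comm hS, innerM_smul_left, cosM, hstar, innerM_comm hS]
    field_simp
  have hproj : projPerp S θstar (normalized S θ₀) = normalized S θ₀ - c • θstar := by
    rw [projPerp, hcn, hss, div_one]
  have hnn : normM S (normalized S θ₀) = 1 := by
    rw [normalized, normM_smul hS, abs_of_pos (by positivity)]
    field_simp
  have hp1 : normM S (projPerp S θstar (normalized S θ₀)) ≤ 1 := by
    rw [hproj, normM, Real.sqrt_le_one]
    have h1 : innerM S (normalized S θ₀) (normalized S θ₀) = 1 := by
      rw [← normM_sq hS, hnn, one_pow]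
    have h2 : innerM S (normalized S θ₀) θstar = c := by rw [innerM_comm hS, hcn]
    rw [innerM_sub_left, innerM_smul_left, innerM_comm hS (normalized S θ₀), innerM_comm hS θstar,
      innerM_sub_left, innerM_sub_left, innerM_smul_left, innerM_smul_left, h1, h2, hcn, hss]
    nlinarith
  -- the part along the ground truth
  have hlower : rhoLower μ S lmin lmax ε 1 θstar ψ θ₀ ≤ - inner ℝ G (act S θstar) := by
    have h1 := (abs_le.1 (h.abs_inner_popGrad_sub_le hε hψ hθ (act S θstar))).2
    have h2 : normM S (act S θstar) ≤ lmax := by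
      simpa [hstar] using normM_act_le hS hlmax hmax θstar
    have h3 : lmin ≤ normM S (act S θstar) := by
      simpa [hstar] using le_normM_act hS hlmin hmin θstar
    rw [innerM_sq hS] at hsψ
    -- Replacing ‖Σθ*‖_Σ by its lower bound λmin is legitimate only because the cosine is
    -- nonnegative.
    have h4 : lmin * cosM S (act S θstar) ψ ≤ innerM S (act S θstar) ψ := by
      rw [cosM, hψ, mul_one]
      rcases (normM_nonneg (S := S) (act S θstar)).eq_or_lt with h0 | h0
      · rw [← h0]; simpa using hsψ
      · rw [mul_div_assoc', div_le_iff₀ h0]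
        nlinarith
    have h5 := mul_le_mul_of_nonneg_left h4 hA0
    have h6 := mul_le_mul_of_nonneg_left h2 hε
    rw [real_inner_comm, rhoLower]
    rw [← hA, ← hG] at *
    nlinarith
  -- the part orthogonal to the ground truth
  have hupper : rhoUpper μ S lmax ε 1 θstar ψ θ₀
      ≤ inner ℝ G (act S (projPerp S θstar (normalized S θ₀))) := by
    set p := projPerp S θstar (normalized S θ₀) with hp
    have h1 := (abs_le.1 (h.abs_inner_popGrad_sub_le hε hψ hθ (act S p))).1
    have h2 : normM S (act S p) ≤ lmax :=
      (normM_act_le hS hlmax hmax p).trans (mul_le_of_le_one_right hlmax hp1)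
    have hpe : projPerp S θstar θ₀ = normM S θ₀ • p := by
      rw [hp, projPerp, projPerp, hss, div_one, div_one, normalized, smul_sub, smul_smul, smul_smul,
        innerM_comm hS θstar (_ • θ₀), innerM_smul_left, innerM_comm hS θ₀, ← mul_assoc,
        mul_one_div_cancel hθpos.ne', one_smul, one_mul]
    have h3 : |cosM S (act S (projPerp S θstar θ₀)) ψ| = |cosM S (act S p) ψ| := by
      rw [hpe, act_smul, cosM, cosM, innerM_smul_left, normM_smul hS, abs_of_pos hθpos, mul_assoc,
        mul_div_mul_left _ _ hθpos.ne']
    have h4 : innerM S (act S p) ψ ≤ lmax * |cosM S (act S p) ψ| := by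
      have h7 := abs_innerM_le hS (act S p) ψ
      rw [cosM, hψ, mul_one, abs_div, abs_of_nonneg (normM_nonneg _)]
      -- If Σp has norm zero the cosine is 0 by the convention `x / 0 = 0`, and Cauchy–Schwarz makes
      -- the left side nonpositive.
      rcases (normM_nonneg (S := S) (act S p)).eq_or_lt with h0 | h0
      · rw [← h0, zero_mul] at h7
        rw [← h0]; simpa using (le_abs_self _).trans h7
      · rw [mul_div_assoc', le_div_iff₀ h0]
        nlinarith [le_abs_self (innerM S (act S p) ψ), abs_nonneg (innerM S (act S p) ψ)]
    have h5 := mul_le_mul_of_nonneg_left h4 hA0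
    have h6 := mul_le_mul_of_nonneg_left h2 hε
    rw [real_inner_comm, rhoUpper, h3]
    rw [← hA, ← hG] at *
    nlinarith
  -- The coefficients 1 - c² and c are exactly the weights of ρ_ℓ and ρ_υ in ρ.
  have hw : θstar - (c / normM S θ₀) • θ₀
      = (1 - c ^ 2) • θstar - c • projPerp S θstar (normalized S θ₀) := by
    rw [hproj, normalized, smul_sub, smul_smul, smul_smul, sub_smul, one_smul, mul_one_div,
      ← pow_two]
    abel
  rw [hw, act_sub, act_smul, act_smul, inner_sub_right, inner_smul_right, inner_smul_right, rho,
    ← hc]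
  have h1 := mul_le_mul_of_nonneg_left hlower (show 0 ≤ 1 - c ^ 2 by nlinarith)
  have h2 := mul_le_mul_of_nonneg_left hupper hc0
  linarith

end PopulationGradient

/-! ### Drift and noise decomposition of the iterates -/

section SFT
variable {d B : ℕ}

/-- Causality of the recursion, the source of independence between an iterate and the current batch.
-/
lemma sft_congr (ψ : Vec d) (η : ℝ) (θ₀ : Vec d) {x y : ℕ → Fin B → Vec d} {t : ℕ}
    (h : ∀ s < t, x s = y s) : sft 1 ψ η θ₀ x t = sft 1 ψ η θ₀ y t := by
  induction t with
  | zero => rfl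
  | succ t ih =>
    rw [sft, sft, ih fun s hs => h s (by omega), h t (by omega)]

lemma measurable_sft {α : Type*} [MeasurableSpace α] (ψ : Vec d) (η : ℝ) (θ₀ : Vec d)
    {x : α → ℕ → Fin B → Vec d} (hx : ∀ s i, Measurable fun a => x a s i) (t : ℕ) :
    Measurable fun a => sft 1 ψ η θ₀ (x a) t := by
  induction t with
  | zero => exact measurable_const
  | succ t ih =>
    simp only [sft, batchGradient_eq]
    have hs : Measurable fun a => ∑ i, sampleGrad ψ (sft 1 ψ η θ₀ (x a) t) (x a t i) :=
      Finset.measurable_fun_sum _ fun i _ => measurable_sampleGrad ψ ih (hx t i)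
    exact ih.sub ((hs.const_smul (1 / (B : ℝ))).const_smul η)

/-- The centred stochastic gradient. -/
def gradNoise (ψ : Vec d) (μ : Measure (Vec d)) (θ x : Vec d) : Vec d :=
  sampleGrad ψ θ x - popGrad ψ μ θ

/-- The accumulated noise of the first `t` steps. -/
def sftNoise (ψ : Vec d) (μ : Measure (Vec d)) (η : ℝ) (θ₀ : Vec d) (x : ℕ → Fin B → Vec d)
    (t : ℕ) : Vec d :=
  (η / B) • ∑ p ∈ Finset.range t ×ˢ (Finset.univ : Finset (Fin B)),
    gradNoise ψ μ (sft 1 ψ η θ₀ x p.1) (x p.1 p.2)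

lemma sft_eq (ψ : Vec d) (μ : Measure (Vec d)) (η : ℝ) (θ₀ : Vec d) (x : ℕ → Fin B → Vec d)
    (hB : 0 < B) (t : ℕ) :
    sft 1 ψ η θ₀ x t = θ₀ - η • ∑ s ∈ Finset.range t, popGrad ψ μ (sft 1 ψ η θ₀ x s)
      - sftNoise ψ μ η θ₀ x t := by
  have hB' : (B : ℝ) ≠ 0 := by positivity
  simp only [sftNoise, Finset.sum_product]
  induction t with
  | zero => simp [sft]
  | succ t ih =>
    have hstep : (η / B) • ∑ i, gradNoise ψ μ (sft 1 ψ η θ₀ x t) (x t i)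
        = η • batchGradient 1 ψ (x t) (sft 1 ψ η θ₀ x t)
          - η • popGrad ψ μ (sft 1 ψ η θ₀ x t) := by
      simp only [gradNoise, Finset.sum_sub_distrib, Finset.sum_const, Finset.card_univ,
        Fintype.card_fin]
      rw [batchGradient_eq, ← Nat.cast_smul_eq_nsmul ℝ, smul_sub, smul_smul, smul_smul,
        div_mul_cancel₀ _ hB', mul_one_div]
    rw [Finset.sum_range_succ, Finset.sum_range_succ, sft, smul_add, smul_add, hstep]
    nth_rewrite 1 [ih]
    abel

end SFT

/-! ### L² orthogonality of the noise increments -/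

section Orthogonality
variable {Ω : Type*} [MeasurableSpace Ω] {P : Measure Ω}
  {F : Type*} [NormedAddCommGroup F] [InnerProductSpace ℝ F]

lemma integrable_inner_of_memLp_two {f g : Ω → F} (hf : MemLp f 2 P) (hg : MemLp g 2 P) :
    Integrable (fun ω => (inner ℝ (f ω) (g ω) : ℝ)) P :=
  (hf.norm.integrable_mul hg.norm).mono' (hf.1.inner hg.1)
    (Filter.Eventually.of_forall fun _ => norm_inner_le_norm _ _)

lemma integral_norm_sum_sq_of_orthogonal {ι : Type*} (s : Finset ι) {V : ι → Ω → F}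
    (hV : ∀ i ∈ s, MemLp (V i) 2 P)
    (horth : ∀ i ∈ s, ∀ j ∈ s, i ≠ j → ∫ ω, inner ℝ (V i ω) (V j ω) ∂P = 0) :
    ∫ ω, ‖∑ i ∈ s, V i ω‖ ^ 2 ∂P = ∑ i ∈ s, ∫ ω, ‖V i ω‖ ^ 2 ∂P := by
  have hint : ∀ i ∈ s, ∀ j ∈ s, Integrable (fun ω => (inner ℝ (V i ω) (V j ω) : ℝ)) P :=
    fun i hi j hj => integrable_inner_of_memLp_two (hV i hi) (hV j hj)
  simp only [← real_inner_self_eq_norm_sq, sum_inner, inner_sum]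
  rw [integral_finsetSum _ fun i hi => integrable_finsetSum _ fun j hj => hint j hj i hi]
  refine Finset.sum_congr rfl fun i hi => ?_
  rw [integral_finsetSum _ fun j hj => hint j hj i hi]
  exact Finset.sum_eq_single_of_mem i hi fun j hj hji => horth j hj i hi hji

/-- A function of `W` is orthogonal to a function of `(W, Z)` that is conditionally centred. -/
lemma integral_inner_eq_zero_of_indepFun [CompleteSpace F] [IsProbabilityMeasure P]
    {α β : Type*} [MeasurableSpace α] [MeasurableSpace β] {μ : Measure β} [IsProbabilityMeasure μ]
    {W : Ω → α} {Z : Ω → β}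
    (hW : Measurable W) (hZ : HasLaw Z μ P) (hWZ : IndepFun W Z P) {f : α → F} {k : α → β → F}
    (hf : StronglyMeasurable f) (hk : StronglyMeasurable fun p : α × β => k p.1 p.2)
    (hki : ∀ a, Integrable (k a) μ) (hk0 : ∀ a, ∫ x, k a x ∂μ = 0)
    (hint : Integrable (fun ω => (inner ℝ (f (W ω)) (k (W ω) (Z ω)) : ℝ)) P) :
    ∫ ω, (inner ℝ (f (W ω)) (k (W ω) (Z ω)) : ℝ) ∂P = 0 := by
  have := Measure.isProbabilityMeasure_map (μ := P) hW.aemeasurable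
  have hlaw : HasLaw (fun ω => (W ω, Z ω)) ((P.map W).prod μ) P :=
    IndepFun.hasLaw_prod ⟨hW.aemeasurable, rfl⟩ hZ hWZ
  have hm : StronglyMeasurable fun p : α × β => (inner ℝ (f p.1) (k p.1 p.2) : ℝ) :=
    (hf.comp_measurable measurable_fst).inner hk
  have h1 : ∫ ω, (inner ℝ (f (W ω)) (k (W ω) (Z ω)) : ℝ) ∂P
      = ∫ p, (inner ℝ (f p.1) (k p.1 p.2) : ℝ) ∂((P.map W).prod μ) :=
    hlaw.integral_comp hm.aestronglyMeasurable
  have h2 : Integrable (fun p : α × β => (inner ℝ (f p.1) (k p.1 p.2) : ℝ))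
      ((P.map W).prod μ) := by
    rw [← hlaw.map_eq, integrable_map_measure hm.aestronglyMeasurable hlaw.aemeasurable]
    exact hint
  -- Fubini, integrating over Z first with W frozen.
  rw [h1, integral_prod _ h2]
  simp [integral_inner (hki _), hk0]

end Orthogonality

/-- The iterates up to time `t`, together with another sample of the first `t + 1` batches, are
independent of a given sample of batch `t`. -/
lemma indepFun_sft_of_le {d B : ℕ} {Ω : Type*} [MeasurableSpace Ω] {P : Measure Ω}
    {X : ℕ → Fin B → Ω → Vec d} (hX : ∀ t i, Measurable (X t i))
    (hind : iIndepFun (fun p : ℕ × Fin B => X p.1 p.2) P) (ψ : Vec d) (η : ℝ) (θ₀ : Vec d)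
    {p q : ℕ × Fin B} (hpq : p ≠ q) (hle : p.1 ≤ q.1) :
    IndepFun (fun ω => ((sft 1 ψ η θ₀ (fun t i => X t i ω) p.1, X p.1 p.2 ω),
      sft 1 ψ η θ₀ (fun t i => X t i ω) q.1)) (X q.1 q.2) P := by
  classical
  -- Batch q.1 is included apart from q itself, since p may lie in the same batch as q.
  set I : Finset (ℕ × Fin B) := (Finset.range (q.1 + 1) ×ˢ Finset.univ).erase q with hI
  have h1 := hind.indepFun_finset I {q} (by simp [hI]) (fun r => hX r.1 r.2)
  -- The value 0 outside I is immaterial: only samples indexed by I are ever read.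
  let ext : (I → Vec d) → ℕ → Fin B → Vec d :=
    fun y t i => if hr : (t, i) ∈ I then y ⟨(t, i), hr⟩ else 0
  have hext (t : ℕ) (i : Fin B) : Measurable fun y => ext y t i := by
    simp only [ext]
    split_ifs with hr
    · exact measurable_pi_apply _
    · exact measurable_const
  have hq : Measurable fun y : ({q} : Finset (ℕ × Fin B)) → Vec d =>
      y ⟨q, Finset.mem_singleton_self q⟩ := measurable_pi_apply _
  have hcomp := h1.comp
    (φ := fun y => ((sft 1 ψ η θ₀ (ext y) p.1, ext y p.1 p.2), sft 1 ψ η θ₀ (ext y) q.1))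
    (((measurable_sft ψ η θ₀ hext p.1).prodMk (hext p.1 p.2)).prodMk
      (measurable_sft ψ η θ₀ hext q.1)) hq
  have hsft (ω : Ω) {t : ℕ} (ht : t ≤ q.1) :
      sft 1 ψ η θ₀ (ext fun r : I => X r.1.1 r.1.2 ω) t = sft 1 ψ η θ₀ (fun t i => X t i ω) t := by
    refine sft_congr ψ η θ₀ fun s hs => funext fun i => ?_
    have hr : (s, i) ∈ I := by
      simp only [hI, Finset.mem_erase, Finset.mem_product, Finset.mem_range, Finset.mem_univ,
        and_true]
      exact ⟨fun h => by rw [← h] at ht; simp at ht; omega, by omega⟩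
    simp [ext, hr]
  have hp : p ∈ I := by
    simp only [hI, Finset.mem_erase, Finset.mem_product, Finset.mem_range, Finset.mem_univ,
      and_true]
    exact ⟨hpq, by omega⟩
  refine hcomp.congr (Filter.Eventually.of_forall fun ω => ?_)
    (Filter.Eventually.of_forall fun ω => rfl)
  simp only [Function.comp_apply, hsft ω hle, hsft ω le_rfl]
  simp [ext, hp]

/-! ### Second moment of the accumulated noise -/

section Noise
variable {d B : ℕ} {μ : Measure (Vec d)} [IsProbabilityMeasure μ] {S : Matrix (Fin d) (Fin d) ℝ}
  {ε b : ℝ} {E : Submodule ℝ (Vec d)}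
  {Ω : Type*} [MeasurableSpace Ω] {P : Measure Ω} [IsProbabilityMeasure P]
  {X : ℕ → Fin B → Ω → Vec d}

lemma IsElliptical.measurable_popGrad (h : IsElliptical μ S ε E) (hb0 : 0 ≤ b)
    (hb : b ∈ upperBounds (spectrum ℝ S)) (ψ : Vec d) : Measurable (popGrad ψ μ) := by
  refine (LipschitzWith.of_dist_le_mul (K := ⟨b, hb0⟩) fun θ θ' => ?_).continuous.measurable
  rw [dist_eq_norm, dist_eq_norm]
  exact h.norm_popGrad_sub_le hb0 hb ψ θ θ'

lemma IsElliptical.measurable_gradNoise (h : IsElliptical μ S ε E) (hb0 : 0 ≤ b)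
    (hb : b ∈ upperBounds (spectrum ℝ S)) (ψ : Vec d) {α : Type*}
    [MeasurableSpace α] {f g : α → Vec d} (hf : Measurable f) (hg : Measurable g) :
    Measurable fun a => gradNoise ψ μ (f a) (g a) :=
  (measurable_sampleGrad ψ hf hg).sub ((h.measurable_popGrad hb0 hb ψ).comp hf)

lemma IsElliptical.integrable_gradNoise (h : IsElliptical μ S ε E) (ψ θ : Vec d) :
    Integrable (gradNoise ψ μ θ) μ :=
  (h.integrable_sampleGrad ψ θ).sub (integrable_const _)

lemma IsElliptical.integral_gradNoise (h : IsElliptical μ S ε E) (ψ θ : Vec d) :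
    ∫ x, gradNoise ψ μ θ x ∂μ = 0 := by
  simp only [gradNoise]
  rw [integral_sub (h.integrable_sampleGrad ψ θ) (integrable_const _)]
  simp [popGrad]

lemma IsElliptical.norm_gradNoise_le (h : IsElliptical μ S ε E)
    (hb : b ∈ upperBounds (spectrum ℝ S)) (ψ θ x : Vec d) :
    ‖gradNoise ψ μ θ x‖ ≤ ‖x‖ + √b :=
  (norm_sub_le _ _).trans (add_le_add (norm_sampleGrad_le ψ θ x) (h.norm_popGrad_le hb ψ θ))

lemma IsElliptical.memLp_gradNoise (h : IsElliptical μ S ε E) (hb0 : 0 ≤ b)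
    (hb : b ∈ upperBounds (spectrum ℝ S)) (ψ : Vec d) {θ Z : Ω → Vec d} (hθ : Measurable θ)
    (hZm : Measurable Z) (hZ : HasLaw Z μ P) :
    MemLp (fun ω => gradNoise ψ μ (θ ω) (Z ω)) 2 P := by
  have hZ2 : MemLp Z 2 P := by
    have := h.memLp_two
    rw [← hZ.map_eq] at this
    exact (memLp_map_measure_iff aestronglyMeasurable_id hZ.aemeasurable).1 this
  refine (hZ2.norm.add (memLp_const √b)).mono'
    (h.measurable_gradNoise hb0 hb ψ hθ hZm).aestronglyMeasurable
    (Filter.Eventually.of_forall fun ω => ?_)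
  exact h.norm_gradNoise_le hb ψ _ _

lemma IsElliptical.integral_norm_gradNoise_sq_le (h : IsElliptical μ S ε E) (hb0 : 0 ≤ b)
    (hb : b ∈ upperBounds (spectrum ℝ S)) (ψ : Vec d) {θ Z : Ω → Vec d} (hθ : Measurable θ)
    (hZm : Measurable Z) (hZ : HasLaw Z μ P) :
    ∫ ω, ‖gradNoise ψ μ (θ ω) (Z ω)‖ ^ 2 ∂P ≤ 2 * (d * b) + 2 * b := by
  have h2 : Integrable (fun x : Vec d => 2 * ‖x‖ ^ 2) μ :=
    (h.memLp_two.integrable_norm_pow (by norm_num)).const_mul 2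
  have hZ2 : Integrable (fun ω => 2 * ‖Z ω‖ ^ 2) P := by
    rw [← hZ.map_eq, integrable_map_measure (by fun_prop) hZ.aemeasurable] at h2
    exact h2
  calc ∫ ω, ‖gradNoise ψ μ (θ ω) (Z ω)‖ ^ 2 ∂P ≤ ∫ ω, (2 * ‖Z ω‖ ^ 2 + 2 * b) ∂P := by
        refine integral_mono ((h.memLp_gradNoise hb0 hb ψ hθ hZm hZ).integrable_norm_pow
          (by norm_num)) (hZ2.add (integrable_const _)) fun ω => ?_
        simp only
        have h1 := h.norm_gradNoise_le hb ψ (θ ω) (Z ω)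
        have h3 := Real.sq_sqrt hb0
        nlinarith [norm_nonneg (gradNoise ψ μ (θ ω) (Z ω)), sq_nonneg (‖Z ω‖ - √b)]
    _ = 2 * (∫ x : Vec d, ‖x‖ ^ 2 ∂μ) + 2 * b := by
        rw [integral_add hZ2 (integrable_const _), integral_const_mul,
          ← hZ.integral_comp (f := fun x : Vec d => ‖x‖ ^ 2) (by fun_prop)]
        simp
    _ ≤ _ := by linarith [h.integral_norm_sq_le hb]

/-- Martingale-type cancellation: given the iterates and the other sample, the later (or
simultaneous) increment has mean zero. -/
lemma IsElliptical.integral_inner_gradNoise_eq_zero (h : IsElliptical μ S ε E) (hb0 : 0 ≤ b)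
    (hb : b ∈ upperBounds (spectrum ℝ S)) (hX : ∀ t i, Measurable (X t i))
    (hlaw : ∀ t i, HasLaw (X t i) μ P)
    (hind : iIndepFun (fun p : ℕ × Fin B => X p.1 p.2) P) (ψ : Vec d) (η : ℝ) (θ₀ : Vec d)
    {p q : ℕ × Fin B} (hpq : p ≠ q) :
    ∫ ω, (inner ℝ (gradNoise ψ μ (sft 1 ψ η θ₀ (fun t i => X t i ω) p.1) (X p.1 p.2 ω))
      (gradNoise ψ μ (sft 1 ψ η θ₀ (fun t i => X t i ω) q.1) (X q.1 q.2 ω)) : ℝ) ∂P = 0 := by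
  wlog hle : p.1 ≤ q.1 generalizing p q
  · rw [← this hpq.symm (not_le.1 hle).le]
    simp only [real_inner_comm]
  have hsft (t : ℕ) : Measurable fun ω => sft 1 ψ η θ₀ (fun t i => X t i ω) t :=
    measurable_sft ψ η θ₀ (x := fun ω t i => X t i ω) hX t
  have hL (r : ℕ × Fin B) := h.memLp_gradNoise hb0 hb ψ (hsft r.1) (hX r.1 r.2) (hlaw r.1 r.2)
  refine integral_inner_eq_zero_of_indepFun
    (W := fun ω => ((sft 1 ψ η θ₀ (fun t i => X t i ω) p.1, X p.1 p.2 ω),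
      sft 1 ψ η θ₀ (fun t i => X t i ω) q.1)) (Z := X q.1 q.2)
    (f := fun a : (Vec d × Vec d) × Vec d => gradNoise ψ μ a.1.1 a.1.2)
    (k := fun (a : (Vec d × Vec d) × Vec d) (x : Vec d) => gradNoise ψ μ a.2 x)
    (((hsft p.1).prodMk (hX p.1 p.2)).prodMk (hsft q.1)) (hlaw q.1 q.2)
    (indepFun_sft_of_le hX hind ψ η θ₀ hpq hle)
    (h.measurable_gradNoise hb0 hb ψ (by fun_prop) (by fun_prop)).stronglyMeasurable
    (h.measurable_gradNoise hb0 hb ψ (by fun_prop) (by fun_prop)).stronglyMeasurable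
    (fun a => h.integrable_gradNoise ψ a.2) (fun a => h.integral_gradNoise ψ a.2)
    (integrable_inner_of_memLp_two (hL p) (hL q))

lemma IsElliptical.integral_norm_sftNoise_sq_le (h : IsElliptical μ S ε E) (hb0 : 0 ≤ b)
    (hb : b ∈ upperBounds (spectrum ℝ S)) (hX : ∀ t i, Measurable (X t i))
    (hlaw : ∀ t i, HasLaw (X t i) μ P)
    (hind : iIndepFun (fun p : ℕ × Fin B => X p.1 p.2) P) (ψ : Vec d) (η : ℝ) (θ₀ : Vec d)
    (t : ℕ) :
    ∫ ω, ‖sftNoise ψ μ η θ₀ (fun t i => X t i ω) t‖ ^ 2 ∂P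
      ≤ (η / B) ^ 2 * ((t * B) * (2 * (d * b) + 2 * b)) := by
  have hsft (t : ℕ) : Measurable fun ω => sft 1 ψ η θ₀ (fun t i => X t i ω) t :=
    measurable_sft ψ η θ₀ (x := fun ω t i => X t i ω) hX t
  simp only [sftNoise, norm_smul, mul_pow, Real.norm_eq_abs, sq_abs]
  rw [integral_const_mul]
  refine mul_le_mul_of_nonneg_left ?_ (sq_nonneg _)
  rw [integral_norm_sum_sq_of_orthogonal _
    (fun p _ => h.memLp_gradNoise hb0 hb ψ (hsft p.1) (hX p.1 p.2) (hlaw p.1 p.2))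
    (fun p _ q _ hpq => h.integral_inner_gradNoise_eq_zero hb0 hb hX hlaw hind ψ η θ₀ hpq)]
  refine (Finset.sum_le_card_nsmul _ _ _ fun p _ =>
    h.integral_norm_gradNoise_sq_le hb0 hb ψ (hsft p.1) (hX p.1 p.2) (hlaw p.1 p.2)).trans_eq ?_
  simp [mul_add]

lemma IsElliptical.memLp_sftNoise (h : IsElliptical μ S ε E) (hb0 : 0 ≤ b)
    (hb : b ∈ upperBounds (spectrum ℝ S)) (hX : ∀ t i, Measurable (X t i))
    (hlaw : ∀ t i, HasLaw (X t i) μ P) (ψ : Vec d) (η : ℝ) (θ₀ : Vec d) (t : ℕ) :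
    MemLp (fun ω => sftNoise ψ μ η θ₀ (fun t i => X t i ω) t) 2 P := by
  have hsft (t : ℕ) : Measurable fun ω => sft 1 ψ η θ₀ (fun t i => X t i ω) t :=
    measurable_sft ψ η θ₀ (x := fun ω t i => X t i ω) hX t
  have hsum := memLp_finsetSum (Finset.range t ×ˢ (Finset.univ : Finset (Fin B))) fun p _ =>
    h.memLp_gradNoise hb0 hb ψ (hsft p.1) (hX p.1 p.2) (hlaw p.1 p.2)
  exact hsum.const_smul (η / B : ℝ)

end Noise

/-! ### Pathwise comparison with a single gradient step -/

section Drift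
variable {F : Type*} [NormedAddCommGroup F] [InnerProductSpace ℝ F] {G : F → F} {θ N : ℕ → F}
  {θ₀ : F} {η M b : ℝ}

lemma norm_sub_init_le (hη : 0 ≤ η)
    (hθ : ∀ t, θ t = θ₀ - η • ∑ s ∈ Finset.range t, G (θ s) - N t) (hG : ∀ φ, ‖G φ‖ ≤ M) (t : ℕ) :
    ‖θ t - θ₀‖ ≤ η * t * M + ‖N t‖ := by
  have h1 : θ t - θ₀ = -(η • ∑ s ∈ Finset.range t, G (θ s)) - N t := by
    rw [hθ]; abel
  rw [h1]
  refine (norm_sub_le _ _).trans ?_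
  rw [norm_neg, norm_smul, Real.norm_of_nonneg hη, mul_assoc]
  gcongr
  refine (norm_sum_le_of_le _ fun s _ => hG (θ s)).trans_eq ?_
  simp

/-- Freezing G at θ₀ costs b‖θ s - θ₀‖ per step, which `norm_sub_init_le` controls; without noise
the total is of order (ηT)². -/
lemma norm_sub_init_add_smul_le (hη : 0 ≤ η)
    (hθ : ∀ t, θ t = θ₀ - η • ∑ s ∈ Finset.range t, G (θ s) - N t) (hG : ∀ φ, ‖G φ‖ ≤ M)
    (hM : 0 ≤ M) (hb : 0 ≤ b) (hLip : ∀ φ φ', ‖G φ - G φ'‖ ≤ b * ‖φ - φ'‖) (T : ℕ) :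
    ‖θ T - θ₀ + (η * T) • G θ₀‖
      ≤ b * (η * (T * (η * T * M) + ∑ s ∈ Finset.range T, ‖N s‖)) + ‖N T‖ := by
  have h1 : θ T - θ₀ + (η * T) • G θ₀
      = -(η • ∑ s ∈ Finset.range T, (G (θ s) - G θ₀)) - N T := by
    rw [hθ, Finset.sum_sub_distrib, Finset.sum_const, Finset.card_range, smul_sub,
      ← Nat.cast_smul_eq_nsmul ℝ, smul_smul]
    abel
  rw [h1]
  refine (norm_sub_le _ _).trans ?_
  rw [norm_neg, norm_smul, Real.norm_of_nonneg hη, mul_left_comm]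
  gcongr
  calc ‖∑ s ∈ Finset.range T, (G (θ s) - G θ₀)‖
      ≤ ∑ s ∈ Finset.range T, b * (η * T * M + ‖N s‖) := by
        refine norm_sum_le_of_le _ fun s hs => (hLip _ _).trans ?_
        have hsT : (s : ℝ) ≤ T := by exact_mod_cast (Finset.mem_range.1 hs).le
        have := norm_sub_init_le hη hθ hG s
        gcongr
        refine this.trans ?_
        gcongr
    _ = b * (T * (η * T * M) + ∑ s ∈ Finset.range T, ‖N s‖) := by
        rw [← Finset.mul_sum, Finset.sum_add_distrib]; simp

end Drift

/-! ### Growth of the cosine with the ground truth -/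

section Gain
variable {d : ℕ} {S : Matrix (Fin d) (Fin d) ℝ}

/-- The budget τρ/4 is shared in the ratio κ : 1 between the curvature loss and the drift loss,
which explains the factor 1 + κ. -/
lemma step_size_le {l κ τ ρ n : ℝ} (hκ : 0 < κ) (hn : 0 < n) (hτ : 0 ≤ τ)
    (h1 : 8 * l ^ 2 * (1 + κ) * τ ≤ ρ) (h2 : 8 * l ^ 2 * (1 + κ) * τ ≤ ρ * n) :
    2 * l ^ 2 * κ * τ ^ 2 / n + 2 * l ^ 2 * τ ^ 2 ≤ τ * ρ / 4 := by
  have h3 : 2 * l ^ 2 * κ * τ ^ 2 / n ≤ κ * (τ * ρ / 4) / (1 + κ) := by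
    rw [div_le_div_iff₀ hn (by positivity)]
    linarith [mul_le_mul_of_nonneg_left h2 (mul_nonneg hκ.le hτ)]
  have h4 : 2 * l ^ 2 * τ ^ 2 ≤ (τ * ρ / 4) / (1 + κ) := by
    rw [le_div_iff₀ (by positivity)]
    linarith [mul_le_mul_of_nonneg_left h1 hτ]
  have h5 : κ * (τ * ρ / 4) / (1 + κ) + (τ * ρ / 4) / (1 + κ) = τ * ρ / 4 := by
    field_simp; ring
  linarith

/-- If the displacement `D` is close to `-τ G`, where `-G` has directional derivative at least `ρ`,
then the cosine with the ground truth increases. -/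
lemma cosM_gain (hS : S.PosDef) {lmin lmax : ℝ} (hlmin : 0 < lmin)
    (hmin : lmin ∈ lowerBounds (spectrum ℝ S)) (hlmax : 0 < lmax)
    (hmax : lmax ∈ upperBounds (spectrum ℝ S)) {θstar θ₀ D G : Vec d} {ρ τ : ℝ}
    (hstar : normM S θstar = 1) (hθ : θ₀ ≠ 0) (hθ₀ : 0 ≤ innerM S θstar θ₀) (hρ0 : 0 < ρ)
    (hρl : ρ ≤ lmax)
    (hρ : ρ ≤ - inner ℝ G (act S (θstar - (cosM S θstar θ₀ / normM S θ₀) • θ₀)))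
    (hnw : ‖act S (θstar - (cosM S θstar θ₀ / normM S θ₀) • θ₀)‖ ≤ √lmax)
    (hτ0 : 0 ≤ τ)
    (hτ1 : 8 * lmax ^ 2 * (1 + 1 / √lmin) * τ ≤ ρ)
    (hτ2 : 8 * lmax ^ 2 * (1 + 1 / √lmin) * τ ≤ ρ * ‖θ₀‖)
    (hD : ‖D‖ ≤ 2 * √lmax * τ)
    (hDG : √lmax * ‖D + τ • G‖ ≤ 2 * lmax ^ 2 * τ ^ 2 + τ * ρ / 4) :
    τ * ρ / (4 * (√lmax * ‖θ₀‖)) ≤ cosM S (θ₀ + D) θstar - cosM S θ₀ θstar := by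
  obtain ⟨L, hL⟩ := exists_innerM_eq_inner hS
  have hnL (x : Vec d) : normM S x = ‖L x‖ := by
    rw [normM, hL, real_inner_self_eq_norm_sq, Real.sqrt_sq (norm_nonneg _)]
  have hsl : 0 < √lmin := Real.sqrt_pos.2 hlmin
  have hsb : 0 < √lmax := Real.sqrt_pos.2 hlmax
  have hsb2 : √lmax ^ 2 = lmax := Real.sq_sqrt hlmax.le
  have hn : 0 < ‖θ₀‖ := norm_pos_iff.2 hθ
  have hθpos := normM_pos hS hθ
  have hlow : √lmin * ‖θ₀‖ ≤ ‖L θ₀‖ := by rw [← hnL]; exact le_normM hS hmin θ₀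
  have hupp : ‖L θ₀‖ ≤ √lmax * ‖θ₀‖ := by rw [← hnL]; exact normM_le hS hmax θ₀
  set c := cosM S θstar θ₀ with hc
  set w := θstar - (c / normM S θ₀) • θ₀ with hw
  have hLθ : 0 < ‖L θ₀‖ := by rw [← hnL]; exact hθpos
  have hstarL : ‖L θstar‖ = 1 := by rw [← hnL, hstar]
  have hcL : c = inner ℝ (L θ₀) (L θstar) / ‖L θ₀‖ := by
    rw [hc, cosM, hL, hnL, hnL, hstarL, one_mul, real_inner_comm]
  have hc0 : 0 ≤ c := div_nonneg hθ₀ (mul_nonneg (normM_nonneg _) (normM_nonneg _))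
  have hc1 : c ≤ 1 := by
    rw [hc, cosM, div_le_one (by rw [hstar]; simpa using hθpos)]
    exact (le_abs_self _).trans (abs_innerM_le hS _ _)
  have hLD : ‖L D‖ ≤ 2 * lmax * τ := by
    rw [← hnL]
    calc normM S D ≤ √lmax * ‖D‖ := normM_le hS hmax D
      _ ≤ √lmax * (2 * √lmax * τ) := by gcongr
      _ = 2 * lmax * τ := by nlinarith
  set κ := 1 / √lmin with hκ
  have hκ0 : 0 < κ := by positivity
  have hκl : κ * √lmin = 1 := by rw [hκ]; field_simp
  have hhalf : ‖L D‖ ≤ ‖L θ₀‖ / 2 := by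
    have h1 : 8 * lmax ^ 2 * κ * τ ≤ lmax * ‖θ₀‖ := by
      have h2 : ρ * ‖θ₀‖ ≤ lmax * ‖θ₀‖ := by gcongr
      have h3 : 0 ≤ 8 * lmax ^ 2 * τ := by positivity
      nlinarith
    have h4 : 8 * lmax * κ * τ ≤ ‖θ₀‖ := by
      refine le_of_mul_le_mul_left ?_ hlmax
      nlinarith
    have h5 : 8 * lmax * τ ≤ √lmin * ‖θ₀‖ := by
      have := mul_le_mul_of_nonneg_left h4 hsl.le
      calc 8 * lmax * τ = √lmin * (8 * lmax * κ * τ) := by linear_combination (-8 * lmax * τ) * hκl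
        _ ≤ _ := this
    have h6 : 0 ≤ lmax * τ := by positivity
    linarith
  -- Of the first-order gain τρ, one quarter pays for the noise and another for both quadratic
  -- losses; half remains.
  have hmain : τ * ρ / 2 ≤ inner ℝ (L D) (L θstar - (c / ‖L θ₀‖) • L θ₀)
      - ‖L D‖ ^ 2 / (2 * ‖L θ₀‖) := by
    have h1 : inner ℝ (L D) (L θstar - (c / ‖L θ₀‖) • L θ₀) = inner ℝ D (act S w) := by
      rw [← map_smul, ← map_sub, ← hL, hw, hnL]; rfl
    have h2 : inner ℝ D (act S w) = inner ℝ (D + τ • G) (act S w) - τ * inner ℝ G (act S w) := by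
      rw [inner_add_left, real_inner_smul_left]; ring
    have h3 : -(2 * lmax ^ 2 * τ ^ 2 + τ * ρ / 4) ≤ inner ℝ (D + τ • G) (act S w) := by
      have h4 := (abs_le.1 (abs_real_inner_le_norm (D + τ • G) (act S w))).1
      have h5 : ‖D + τ • G‖ * ‖act S w‖ ≤ ‖D + τ • G‖ * √lmax := by gcongr
      linarith
    have h6 := mul_le_mul_of_nonneg_left hρ hτ0
    have h7 : ‖L D‖ ^ 2 / (2 * ‖L θ₀‖) ≤ 2 * lmax ^ 2 * κ * τ ^ 2 / ‖θ₀‖ := by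
      calc ‖L D‖ ^ 2 / (2 * ‖L θ₀‖) ≤ (2 * lmax * τ) ^ 2 / (2 * (√lmin * ‖θ₀‖)) := by gcongr
        _ = _ := by rw [hκ]; field_simp
    have h8 : 2 * lmax ^ 2 * κ * τ ^ 2 / ‖θ₀‖ + 2 * lmax ^ 2 * τ ^ 2 ≤ τ * ρ / 4 :=
      step_size_le hκ0 hn hτ0 hτ1 hτ2
    rw [h1, h2]
    linarith
  have hgain := cos_gain (norm_pos_iff.1 hLθ) hc0 hc1 (by rw [hcL]; field_simp) hhalf
    (by positivity) hmain
  rw [← map_add] at hgain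
  have e1 : cosM S (θ₀ + D) θstar = inner ℝ (L (θ₀ + D)) (L θstar) / ‖L (θ₀ + D)‖ := by
    rw [cosM, hL, hnL, hnL, hstarL, mul_one]
  have e2 : cosM S θ₀ θstar = c := by
    rw [hcL, cosM, hL, hnL, hnL, hstarL, mul_one]
  rw [e1, e2]
  refine le_trans ?_ hgain
  rw [div_div]
  have : 2 * (2 * ‖L θ₀‖) ≤ 4 * (√lmax * ‖θ₀‖) := by linarith
  gcongr

/-- The vector is the part of θ* orthogonal to θ₀, with squared S-norm 1 - c² ≤ 1. -/
lemma norm_act_sub_cosM_smul_le (hS : S.PosDef) {b : ℝ} (hb : b ∈ upperBounds (spectrum ℝ S))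
    {θstar θ₀ : Vec d} (hstar : normM S θstar = 1) (hθ : θ₀ ≠ 0) :
    ‖act S (θstar - (cosM S θstar θ₀ / normM S θ₀) • θ₀)‖ ≤ √b := by
  have hθpos := normM_pos hS hθ
  refine (norm_act_le hS hb _).trans (mul_le_of_le_one_right (Real.sqrt_nonneg _) ?_)
  rw [normM, Real.sqrt_le_one]
  have hss : innerM S θstar θstar = 1 := by rw [← normM_sq hS, hstar, one_pow]
  set n := normM S θ₀ with hn
  have h00 : innerM S θ₀ θ₀ = n ^ 2 := by rw [← normM_sq hS]
  have hc : innerM S θstar θ₀ = cosM S θstar θ₀ * n := by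
    rw [cosM, hstar, ← hn]; field_simp
  set c := cosM S θstar θ₀
  have hc' : innerM S θ₀ θstar = c * n := by rw [innerM_comm hS, hc]
  rw [innerM_sub_left, innerM_smul_left, innerM_comm hS θstar, innerM_comm hS θ₀, innerM_sub_left,
    innerM_sub_left, innerM_smul_left, innerM_smul_left, hss, h00, hc, hc']
  have : 1 - c / n * (c * n) - c / n * (c * n - c / n * n ^ 2) = 1 - c ^ 2 := by
    field_simp; ring
  rw [this]
  nlinarith

end Gain

/-! ### Probability of large noise -/

/-- An event determined by the samples may be bounded for measurable versions of the samples. -/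
lemma measureReal_le_of_forall_measurable {d B : ℕ} {μ : Measure (Vec d)}
    {Ω : Type*} [MeasurableSpace Ω] {P : Measure Ω} {X : ℕ → Fin B → Ω → Vec d} {c : ℝ} (Q : (ℕ → Fin B → Vec d) → Prop)
    (h : ∀ Y : ℕ → Fin B → Ω → Vec d, (∀ t i, Measurable (Y t i)) →
      (∀ t i, HasLaw (Y t i) μ P) → iIndepFun (fun p : ℕ × Fin B => Y p.1 p.2) P →
      P.real {ω | Q fun t i => Y t i ω} ≤ c)
    (hlaw : ∀ t i, HasLaw (X t i) μ P)
    (hind : iIndepFun (fun p : ℕ × Fin B => X p.1 p.2) P) :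
    P.real {ω | Q fun t i => X t i ω} ≤ c := by
  have hae (t : ℕ) (i : Fin B) : X t i =ᵐ[P] (hlaw t i).aemeasurable.mk (X t i) :=
    (hlaw t i).aemeasurable.ae_eq_mk
  have hall : ∀ᵐ ω ∂P, ∀ t i, X t i ω = (hlaw t i).aemeasurable.mk (X t i) ω :=
    ae_all_iff.2 fun t => ae_all_iff.2 fun i => hae t i
  refine le_trans (le_of_eq ?_) (h (fun t i => (hlaw t i).aemeasurable.mk (X t i))
    (fun t i => (hlaw t i).aemeasurable.measurable_mk)
    (fun t i => (hlaw t i).congr (hae t i).symm) (hind.congr fun p => hae p.1 p.2))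
  refine measureReal_congr ?_
  filter_upwards [hall] with ω hω
  have : (fun t i => X t i ω) = fun t i => (hlaw t i).aemeasurable.mk (X t i) ω :=
    funext fun t => funext fun i => hω t i
  exact congrArg Q this

section Probability
variable {d B : ℕ} {μ : Measure (Vec d)} [IsProbabilityMeasure μ] {S : Matrix (Fin d) (Fin d) ℝ}
  {ε b : ℝ} {E : Submodule ℝ (Vec d)}
  {Ω : Type*} [MeasurableSpace Ω] {P : Measure Ω} [IsProbabilityMeasure P]
  {X : ℕ → Fin B → Ω → Vec d}

/-- Markov's inequality for Z = ‖N_T‖² + (1/T)∑‖N_s‖²: if Z < r², both bounds hold, the second by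
Cauchy–Schwarz. Only the average of the ‖N_s‖ matters for the drift, so no maximal inequality is
needed. As T ≥ 1, η²T ≤ (ηT)², which leaves a bound in the total step length alone. -/
lemma IsElliptical.measureReal_sftNoise_le (h : IsElliptical μ S ε E) (hb0 : 0 ≤ b)
    (hb : b ∈ upperBounds (spectrum ℝ S)) (hX : ∀ t i, Measurable (X t i))
    (hlaw : ∀ t i, HasLaw (X t i) μ P)
    (hind : iIndepFun (fun p : ℕ × Fin B => X p.1 p.2) P) (ψ : Vec d) (η : ℝ) (θ₀ : Vec d)
    {T : ℕ} (hT : 0 < T) (hB : 0 < B) (hd : 0 < d) {r : ℝ} (hr : 0 < r) :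
    P.real {ω | ¬ (‖sftNoise ψ μ η θ₀ (fun t i => X t i ω) T‖ ≤ r ∧
      ∑ s ∈ Finset.range T, ‖sftNoise ψ μ η θ₀ (fun t i => X t i ω) s‖ ≤ T * r)}
      ≤ 8 * (η * T) ^ 2 * (d * b) / (B * r ^ 2) := by
  have hT' : (0 : ℝ) < T := by exact_mod_cast hT
  have hT1 : (1 : ℝ) ≤ T := by exact_mod_cast hT
  have hB' : (0 : ℝ) < B := by exact_mod_cast hB
  have hd1 : (1 : ℝ) ≤ d := by exact_mod_cast hd
  set N : ℕ → Ω → Vec d := fun t ω => sftNoise ψ μ η θ₀ (fun t i => X t i ω) t with hN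
  have hint (t : ℕ) : Integrable (fun ω => ‖N t ω‖ ^ 2) P :=
    (h.memLp_sftNoise hb0 hb hX hlaw ψ η θ₀ t).integrable_norm_pow (by norm_num)
  have hbound : ∀ t ≤ T, ∫ ω, ‖N t ω‖ ^ 2 ∂P ≤ 4 * (η * T) ^ 2 * (d * b) / B := by
    intro t ht
    refine (h.integral_norm_sftNoise_sq_le hb0 hb hX hlaw hind ψ η θ₀ t).trans ?_
    have ht' : (t : ℝ) ≤ T := by exact_mod_cast ht
    have h1 : 2 * (d * b) + 2 * b ≤ 4 * (d * b) := by nlinarith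
    calc (η / B) ^ 2 * ((t * B) * (2 * (d * b) + 2 * b))
        ≤ (η / B) ^ 2 * ((T * B) * (4 * (d * b))) := by gcongr
      _ = 4 * (η ^ 2 * T) * (d * b) / B := by field_simp
      _ ≤ 4 * (η * T) ^ 2 * (d * b) / B := by
        have : η ^ 2 * T ≤ (η * T) ^ 2 := by
          rw [mul_pow]
          exact mul_le_mul_of_nonneg_left (by nlinarith) (sq_nonneg _)
        gcongr
  set Z : Ω → ℝ := fun ω => ‖N T ω‖ ^ 2 + (1 / T) * ∑ s ∈ Finset.range T, ‖N s ω‖ ^ 2 with hZ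
  have hZi : Integrable Z P :=
    (hint T).add ((integrable_finsetSum _ fun s _ => hint s).const_mul _)
  have hZ0 : 0 ≤ᵐ[P] Z := Filter.Eventually.of_forall fun ω => by simp only [hZ]; positivity
  have hZb : ∫ ω, Z ω ∂P ≤ 8 * (η * T) ^ 2 * (d * b) / B := by
    simp only [hZ]
    rw [integral_add (hint T) ((integrable_finsetSum _ fun s _ => hint s).const_mul _),
      integral_const_mul, integral_finsetSum _ fun s _ => hint s]
    have h1 : ∑ s ∈ Finset.range T, ∫ ω, ‖N s ω‖ ^ 2 ∂P
        ≤ T * (4 * (η * T) ^ 2 * (d * b) / B) := by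
      refine (Finset.sum_le_card_nsmul _ _ _ fun s hs =>
        hbound s (Finset.mem_range.1 hs).le).trans_eq ?_
      simp
    have h2 : (1 / (T : ℝ)) * ∑ s ∈ Finset.range T, ∫ ω, ‖N s ω‖ ^ 2 ∂P
        ≤ 4 * (η * T) ^ 2 * (d * b) / B := by
      rw [one_div, inv_mul_le_iff₀ hT']
      exact h1
    have h3 := hbound T le_rfl
    have h4 : 8 * (η * T) ^ 2 * (d * b) / B
        = 4 * (η * T) ^ 2 * (d * b) / B + 4 * (η * T) ^ 2 * (d * b) / B := by ring
    linarith
  have hsub : {ω | ¬ (‖N T ω‖ ≤ r ∧ ∑ s ∈ Finset.range T, ‖N s ω‖ ≤ T * r)}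
      ⊆ {ω | r ^ 2 ≤ Z ω} := by
    intro ω hω
    by_contra hlt
    rw [Set.mem_ofPred_eq, not_le] at hlt
    simp only [hZ] at hlt
    refine hω ⟨abs_le_of_sq_le_sq' ?_ hr.le |>.2, abs_le_of_sq_le_sq' ?_ (by positivity) |>.2⟩
    · have : 0 ≤ (1 / (T : ℝ)) * ∑ s ∈ Finset.range T, ‖N s ω‖ ^ 2 := by positivity
      linarith
    · have h1 := sq_sum_le_card_mul_sum_sq (s := Finset.range T) (f := fun s => ‖N s ω‖)
      rw [Finset.card_range] at h1
      have h2 : (1 / (T : ℝ)) * ∑ s ∈ Finset.range T, ‖N s ω‖ ^ 2 ≤ r ^ 2 := by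
        linarith [sq_nonneg ‖N T ω‖]
      rw [one_div, inv_mul_le_iff₀ hT'] at h2
      calc _ ≤ _ := h1
        _ ≤ T * (T * r ^ 2) := by gcongr
        _ = (T * r) ^ 2 := by ring
  refine (measureReal_mono hsub).trans ?_
  have hmk := mul_meas_ge_le_integral_of_nonneg hZ0 hZi (r ^ 2)
  rw [← div_div, le_div_iff₀ (by positivity), mul_comm]
  exact hmk.trans hZb

end Probability

end WeakToStrong

end

/-! ### Choice of constants and conclusion -/

theorem mainTheorem1 (lmin lmax : ℝ) (hlmin : 0 < lmin) (hle : lmin ≤ lmax) :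
    ∃ C₀ C₁ C₂ C₃ : ℝ, 0 < C₀ ∧ 0 < C₁ ∧ 0 < C₂ ∧ 0 < C₃ ∧
      ∀ (d : ℕ) (μ : Measure (WeakToStrong.Vec d)), IsProbabilityMeasure μ →
      ∀ (S : Matrix (Fin d) (Fin d) ℝ) (ε : ℝ) (θstar ψ θ₀ : WeakToStrong.Vec d),
        0 ≤ ε →
        WeakToStrong.IsElliptical μ S ε (Submodule.span ℝ {ψ, θ₀}) →
        IsLeast (spectrum ℝ S) lmin →
        IsGreatest (spectrum ℝ S) lmax →
        WeakToStrong.normM S θstar = 1 →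
        WeakToStrong.normM S ψ = 1 →
        θ₀ ≠ 0 →
        0 ≤ WeakToStrong.innerM (S ^ 2) θstar θ₀ →
        0 ≤ WeakToStrong.innerM S θstar θ₀ →
        0 ≤ WeakToStrong.innerM (S ^ 2) θstar ψ →
        ∀ ρ : ℝ, ρ = WeakToStrong.rho μ S lmin lmax ε 1 θstar ψ θ₀ → 0 < ρ →
        ∀ Δ : ℝ, Δ = C₂ * (ρ / (‖θ₀‖ + 1 + ε)) ^ 2 →
        ∃ τ : ℝ, 0 < τ ∧ τ ≤ C₀ * (ρ / ‖θ₀‖) ∧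
          ∀ (T B : ℕ), 0 < T → 0 < B →
          ∀ η : ℝ, η = τ / T → η ≤ C₁ * (ρ / (‖θ₀‖ + 1 + ε)) ^ 3 →
          ∀ (Ω : Type*) (mΩ : MeasurableSpace Ω) (P : Measure Ω), IsProbabilityMeasure P →
          ∀ X : ℕ → Fin B → Ω → WeakToStrong.Vec d,
            (∀ t i, HasLaw (X t i) μ P) →
            iIndepFun (fun p : ℕ × Fin B => X p.1 p.2) P →
            P.real {ω | ¬ (Δ ≤
                WeakToStrong.cosM S
                    (WeakToStrong.sft 1 ψ η θ₀ (fun t i => X t i ω) T) θstar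
                  - WeakToStrong.cosM S θ₀ θstar)}
              ≤ C₃ * (d / (B * Δ)) * (1 / (‖θ₀‖ * ρ) + 1 / ρ ^ 2) := by
  set κ := 1 / √lmin with hκ
  have hlmax : 0 < lmax := hlmin.trans_le hle
  have hκ0 : 0 < κ := one_div_pos.2 (Real.sqrt_pos.2 hlmin)
  have hsb : 0 < √lmax := Real.sqrt_pos.2 hlmax
  have hsb2 : √lmax * √lmax = lmax := Real.mul_self_sqrt hlmax.le
  set K := 8 * lmax ^ 2 * (1 + κ) with hK
  have hK0 : 0 < K := by positivity
  refine ⟨1 / K, 1, 1 / (4 * √lmax * K), 128 * lmax ^ 4 * (1 / (4 * √lmax * K)), by positivity,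
    one_pos, by positivity, by positivity, ?_⟩
  intro d μ hμ S ε θstar ψ θ₀ hε h hleast hgreatest hstar hψ hθ hθ2 hθ₀ hsψ ρ hρ hρ0 Δ hΔ
  have hS := h.posDef
  have hn : 0 < ‖θ₀‖ := norm_pos_iff.2 hθ
  have hd : 0 < d := by
    rcases Nat.eq_zero_or_pos d with rfl | hd
    · exact absurd (Subsingleton.elim θ₀ 0) hθ
    · exact hd
  have hdir := h.rho_le hε hlmin.le hleast.2 hlmax.le hgreatest.2 hstar hψ hθ hθ₀ hsψ
  rw [← hρ] at hdir
  have hnw := WeakToStrong.norm_act_sub_cosM_smul_le hS hgreatest.2 hstar hθ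
  have hG := h.norm_popGrad_le hgreatest.2 ψ
  -- Cauchy–Schwarz, with both G and Σw of norm at most √λmax.
  have hρl : ρ ≤ lmax := by
    have h1 := (abs_le.1 (abs_real_inner_le_norm (WeakToStrong.popGrad ψ μ θ₀) (WeakToStrong.act S
      (θstar - (WeakToStrong.cosM S θstar θ₀ / WeakToStrong.normM S θ₀) • θ₀)))).1
    have h2 := mul_le_mul (hG θ₀) hnw (norm_nonneg _) hsb.le
    linarith
  -- the total step length
  set τ := ρ * ‖θ₀‖ / (K * (‖θ₀‖ + 1) ^ 2) with hτ
  have hτ0 : 0 < τ := by positivity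
  have hKτ : K * τ = ρ * (‖θ₀‖ / (‖θ₀‖ + 1) ^ 2) := by rw [hτ]; field_simp
  have hτ1 : K * τ ≤ ρ := by
    rw [hKτ]
    refine mul_le_of_le_one_right hρ0.le ?_
    rw [div_le_one (by positivity)]
    nlinarith
  have hτ2 : K * τ ≤ ρ * ‖θ₀‖ := by
    rw [hKτ]
    gcongr
    exact div_le_self hn.le (by nlinarith)
  have hΔgain : Δ ≤ τ * ρ / (4 * (√lmax * ‖θ₀‖)) := by
    calc Δ ≤ 1 / (4 * √lmax * K) * (ρ / (‖θ₀‖ + 1)) ^ 2 := by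
          have : ρ / (‖θ₀‖ + 1 + ε) ≤ ρ / (‖θ₀‖ + 1) :=
            div_le_div_of_nonneg_left hρ0.le (by positivity) (by linarith)
          rw [hΔ]; gcongr
      _ = τ * ρ / (4 * (√lmax * ‖θ₀‖)) := by rw [hτ]; field_simp
  refine ⟨τ, hτ0, ?_, ?_⟩
  · have h1 : 1 / K * (ρ / ‖θ₀‖) = ρ / (K * ‖θ₀‖) := by field_simp
    rw [hτ, h1, div_le_div_iff₀ (by positivity) (by positivity)]
    have h2 : ‖θ₀‖ * ‖θ₀‖ ≤ (‖θ₀‖ + 1) ^ 2 := by nlinarith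
    have h3 := mul_le_mul_of_nonneg_left h2 (mul_nonneg hρ0.le hK0.le)
    linarith
  intro T B hT hB η hη _ Ω mΩ P hP X hlaw hind
  have hT' : (0 : ℝ) < T := by exact_mod_cast hT
  have hB' : (0 : ℝ) < B := by exact_mod_cast hB
  have hητ : η * T = τ := by rw [hη]; field_simp
  have hη0 : 0 ≤ η := by rw [hη]; positivity
  -- The noise level for which √λmax · r is the share τρ/4 allotted to noise in `cosM_gain`.
  set r := τ * ρ / (4 * √lmax) with hr
  have hr0 : 0 < r := by positivity
  have hrτ : r ≤ √lmax * τ := by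
    rw [hr, div_le_iff₀ (by positivity)]
    have : τ * ρ ≤ τ * lmax := by gcongr
    nlinarith
  refine WeakToStrong.measureReal_le_of_forall_measurable (fun x => ¬ (Δ ≤
    WeakToStrong.cosM S (WeakToStrong.sft 1 ψ η θ₀ x T) θstar - WeakToStrong.cosM S θ₀ θstar))
    (fun Y hY hYlaw hYind => ?_) hlaw hind
  have hnoise := h.measureReal_sftNoise_le hlmax.le hgreatest.2 hY hYlaw hYind ψ η θ₀ hT hB hd hr0
  have hsub : {ω | ¬ (Δ ≤ WeakToStrong.cosM S
        (WeakToStrong.sft 1 ψ η θ₀ (fun t i => Y t i ω) T) θstar - WeakToStrong.cosM S θ₀ θstar)}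
      ⊆ {ω | ¬ (‖WeakToStrong.sftNoise ψ μ η θ₀ (fun t i => Y t i ω) T‖ ≤ r ∧
        ∑ s ∈ Finset.range T, ‖WeakToStrong.sftNoise ψ μ η θ₀ (fun t i => Y t i ω) s‖
          ≤ T * r)} := by
    intro ω hω hgood
    refine hω (hΔgain.trans ?_)
    obtain ⟨hN, hNsum⟩ := hgood
    have heq := WeakToStrong.sft_eq ψ μ η θ₀ (fun t i => Y t i ω) hB
    have hD := WeakToStrong.norm_sub_init_le hη0 heq hG T
    have hDG := WeakToStrong.norm_sub_init_add_smul_le hη0 heq hG hsb.le hlmax.le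
      (h.norm_popGrad_sub_le hlmax.le hgreatest.2 ψ) T
    rw [hητ] at hD hDG
    have hgain := WeakToStrong.cosM_gain (D := WeakToStrong.sft 1 ψ η θ₀ (fun t i => Y t i ω) T - θ₀)
      hS hlmin hleast.2 hlmax hgreatest.2 hstar hθ hθ₀ hρ0 hρl hdir hnw hτ0.le hτ1 hτ2
      (by linarith) ?_
    · rwa [add_sub_cancel] at hgain
    · have h1 : η * (T * (τ * √lmax)
          + ∑ s ∈ Finset.range T, ‖WeakToStrong.sftNoise ψ μ η θ₀ (fun t i => Y t i ω) s‖)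
          ≤ τ * (2 * (√lmax * τ)) := by
        calc _ ≤ η * (T * (τ * √lmax) + T * r) := by gcongr
          _ = τ * (τ * √lmax + r) := by rw [← hητ]; ring
          _ ≤ _ := by gcongr; linarith
      calc _ ≤ √lmax * (lmax * (τ * (2 * (√lmax * τ))) + r) := by
            refine mul_le_mul_of_nonneg_left (hDG.trans ?_) hsb.le
            exact add_le_add (mul_le_mul_of_nonneg_left h1 hlmax.le) hN
        _ = 2 * lmax * (√lmax * √lmax) * τ ^ 2 + √lmax * r := by ring
        _ = 2 * lmax ^ 2 * τ ^ 2 + τ * ρ / 4 := by rw [hsb2, hr]; field_simp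
        _ ≤ _ := le_rfl
  refine (measureReal_mono hsub).trans (hnoise.trans ?_)
  have hΔ0 : 0 < Δ := by rw [hΔ]; positivity
  -- Δ is bounded by a constant, so the tail 128λmax² d/(Bρ²) can be written with the factor d/(BΔ).
  have hΔle : Δ ≤ 1 / (4 * √lmax * K) * lmax ^ 2 := by
    rw [hΔ]
    gcongr
    exact (div_le_self hρ0.le (by linarith)).trans hρl
  set C := 1 / (4 * √lmax * K) with hC
  have hr2 : r ^ 2 = τ ^ 2 * ρ ^ 2 / (16 * lmax) := by
    rw [hr, div_pow, mul_pow, mul_pow, pow_two √lmax, hsb2]; norm_num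
  calc 8 * (η * T) ^ 2 * (d * lmax) / (B * r ^ 2) = 128 * lmax ^ 2 * (d / B) * (1 / ρ ^ 2) := by
        rw [hητ, hr2]; field_simp; norm_num
    _ = 128 * lmax ^ 2 * Δ * (d / (B * Δ)) * (1 / ρ ^ 2) := by field_simp
    _ ≤ 128 * lmax ^ 2 * (C * lmax ^ 2) * (d / (B * Δ)) * (1 / ρ ^ 2) := by gcongr
    _ = 128 * lmax ^ 4 * C * (d / (B * Δ)) * (1 / ρ ^ 2) := by ring
    _ ≤ 128 * lmax ^ 4 * C * (d / (B * Δ)) * (1 / (‖θ₀‖ * ρ) + 1 / ρ ^ 2) := by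
        gcongr
        have : 0 ≤ 1 / (‖θ₀‖ * ρ) := by positivity
        linarith
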